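/- **Theorem (Bethe Ansatz for $V$).** Let $c>0$, $\Delta=(2-c^2)/2$, let $N\ge 1$ be an integer and let $n\ge 0$ be an integer with $n\le N/2$. *Transfer matrix.* For each $\vec x=(x_1,\dots,x_m)$ with integers $1\le x_1<\dots<x_m\le N$, $0\le m\le N$, write $|\vec x|=m$ and let $\Psi_{\vec x}\in\{\pm1\}^N$ be equal to $+1$ at $x_1,\dots,x_m$ and $-1$ elsewhere. Let $\Omega$ be the $2^N$-dimensional complex vector space with basis $(\Psi_{\vec x})_{\vec x}$. Call $\Psi_{\vec x},\Psi_{\vec y}$ interlaced if $|\vec x|=|\vec y|=m$ and either $x_1\le y_1\le x_2\le\dots\le x_m\le y_m$ or $y_1\le x_1\le y_2\le\dots\le y_m\le x_m$. The transfer matrix $V$ of the six-vertex model with weights $a=b=1$ and $c$ is the matrix, in the basis $(\Psi_{\vec x})$, with entries $V(\Psi_{\vec x},\Psi_{\vec x})=2$; $V(\Psi_{\vec x},\Psi_{\vec y})=c^{P(\Psi_{\vec x},\Psi_{\vec y})}$ if $\vec x\ne\vec y$ and $\Psi_{\vec x},\Psi_{\vec y}$ are interlaced, where $P(\Psi_{\vec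 x},\Psi_{\vec y})=|\{i:\Psi_{\vec x}(i)\ne\Psi_{\vec y}(i)\}|$; and $0$ otherwise. *Functions.* Put $S(x,y)=e^{-ix}+e^{iy}-2\Delta$. If $\Delta\in[-1,1)$ let $\mu\in[0,\pi)$ be the solution of $\cos\mu=-\Delta$; if $\Delta<-1$ let $\mu=0$. Let $\mathcal D_\Delta=(-\pi+\mu,\pi-\mu)$, and let $\Theta:\mathcal D_\Delta^2\to\mathbb R$ be the unique continuous function with $\Theta(0,0)=0$ and $\exp(-i\Theta(x,y))=e^{i(x-y)}\,S(x,y)/S(y,x)$. For $z\ne1$ put $L(z)=1+\frac{c^2z}{1-z}$ and $M(z)=1-\frac{c^2}{1-z}$. *Claim.* Let $p_1,\dots,p_n\in\mathcal D_\Delta$ be distinct and satisfy Bethe's equations $$\exp(iNp_j)=(-1)^{n-1}\exp\Big(-i\sum_{k=1}^n\Theta(p_j,p_k)\Big)\qquad\text{for all } j\in\{1,\dots,n\}.\tag{BE}$$ Let $\psi=\sum_{|\vec x|=n}\psi(\vec x)\,\Psi_{\vec x}\in\Omega$, where $$\psi(\vec x)=\sum_{\sigma\in\mathfrak S_n}A_\sigma\prod_{k=1}^n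 e^{ip_{\sigma(k)}x_k},\qquad A_\sigma=\varepsilon(\sigma)\prod_{1\le k<\ell\le n}e^{ip_{\sigma(k)}}S(p_{\sigma(k)},p_{\sigma(\ell)}),$$ and $\varepsilon(\sigma)$ is the signature of $\sigma$. Then $V\psi=\Lambda\psi$, where $$\Lambda=\prod_{j=1}^nL(e^{ip_j})+\prod_{j=1}^nM(e^{ip_j})\quad\text{if } p_1,\dots,p_n \text{ are all non-zero,}$$ $$\Lambda=\Big[2+c^2(N-1)+c^2\sum_{j\ne\ell}\partial_1\Theta(0,p_j)\Big]\cdot\prod_{j\ne\ell}M(e^{ip_j})\quad\text{if } p_\ell=0 \text{ for some } \ell,$$ and in the second case the partial derivatives $\partial_1\Theta(0,p_j)$, $j\neq\ell$, exist. -/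

import Mathlib

namespace SixVertex

noncomputable section

/-! ### Arrow configurations of a row and the transfer matrix

A row of vertical arrows on `ℤ_N` is encoded by the set `s : Finset (Fin N)` of the sites that
carry an up arrow. The site `i : Fin N` stands for the integer `i + 1 ∈ {1, …, N}`. The space `Ω`
spanned by the basis `Ψ_s` is `Finset (Fin N) → ℂ` (with complex scalars, as `ψ` is complex). -/

/-- The `±1`-configuration `Ψ_s`. -/
def spin {N : ℕ} (s : Finset (Fin N)) (i : Fin N) : ℤ :=
  if i ∈ s then 1 else -1

/-- The ordered coordinates `1 ≤ x_1 < ⋯ < x_n ≤ N` of the up arrows of `s`. -/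
def coord {N n : ℕ} (s : Finset (Fin N)) (h : s.card = n) (k : Fin n) : ℕ :=
  (s.orderEmbOfFin h k : ℕ) + 1

/-- `x_1 ≤ y_1 ≤ x_2 ≤ y_2 ≤ ⋯ ≤ x_n ≤ y_n`. -/
def Chain {n : ℕ} (x y : Fin n → ℕ) : Prop :=
  (∀ k, x k ≤ y k) ∧ ∀ k l : Fin n, (k : ℕ) + 1 = l → y k ≤ x l

/-- Two rows are interlaced: same number `n` of up arrows, and
`x_1 ≤ y_1 ≤ ⋯ ≤ x_n ≤ y_n` or `y_1 ≤ x_1 ≤ ⋯ ≤ y_n ≤ x_n`. -/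
def Interlaced {N : ℕ} (s t : Finset (Fin N)) : Prop :=
  ∃ (n : ℕ) (hs : s.card = n) (ht : t.card = n),
    Chain (coord s hs) (coord t ht) ∨ Chain (coord t ht) (coord s hs)

/-- The number of sites at which two rows differ. -/
def diffCount {N : ℕ} (s t : Finset (Fin N)) : ℕ :=
  (Finset.univ.filter fun i : Fin N => spin s i ≠ spin t i).card

open Classical in
/-- The transfer matrix of the six-vertex model with weights `a = b = 1` and `c`. -/
def transferMatrix (N : ℕ) (c : ℝ) : Matrix (Finset (Fin N)) (Finset (Fin N)) ℝ :=
  Matrix.of fun s t =>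
    if s = t then 2 else if Interlaced s t then c ^ diffCount s t else 0

/-! ### The functions entering Bethe's equations -/

/-- `Δ = (2 - c²) / 2`. -/
def anisotropy (c : ℝ) : ℝ := (2 - c ^ 2) / 2

/-- `S(x, y) = e^{-ix} + e^{iy} - 2Δ`. -/
def S (Δ x y : ℝ) : ℂ :=
  Complex.exp (-(Complex.I * x)) + Complex.exp (Complex.I * y) - 2 * Δ

/-- For `Δ ∈ [-1, 1)`, the solution `μ ∈ [0, π)` of `cos μ = -Δ`; for `Δ < -1`, zero. -/
def mu (Δ : ℝ) : ℝ := if Δ < -1 then 0 else Real.arccos (-Δ)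

/-- The interval `D_Δ = (-π + μ, π - μ)`. -/
def D (Δ : ℝ) : Set ℝ := Set.Ioo (-Real.pi + mu Δ) (Real.pi - mu Δ)

/-- `Θ` is continuous on `D_Δ²`, vanishes at `(0, 0)`, and satisfies
`exp(-iΘ(x, y)) = e^{i(x - y)} S(x, y) / S(y, x)` on `D_Δ²`. Values outside `D_Δ²` are
irrelevant. -/
structure IsTheta (Δ : ℝ) (Θ : ℝ → ℝ → ℝ) : Prop where
  continuousOn : ContinuousOn (fun q : ℝ × ℝ => Θ q.1 q.2) (D Δ ×ˢ D Δ)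
  zero : Θ 0 0 = 0
  exp_eq : ∀ x ∈ D Δ, ∀ y ∈ D Δ,
    Complex.exp (-(Complex.I * (Θ x y : ℂ))) =
      Complex.exp (Complex.I * ((x : ℂ) - y)) * (S Δ x y / S Δ y x)

/-- The function `Θ`. For `Δ < 1` it is well defined on `D_Δ²`:
see `isTheta_theta` and `theta_unique`. -/
def theta (Δ : ℝ) : ℝ → ℝ → ℝ := Classical.epsilon (IsTheta Δ)

/-- `cos((x + y)/2) - Δ e^{i(x - y)/2}`, which is half of `e^{i(x - y)/2} S(x, y)`. -/
def halfPhase (Δ x y : ℝ) : ℂ :=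
  (Real.cos ((x + y) / 2) : ℂ) - Δ * Complex.exp (Complex.I * (((x - y) / 2 : ℝ) : ℂ))

theorem mu_nonneg (Δ : ℝ) : 0 ≤ mu Δ := by
  unfold mu
  split_ifs
  · exact le_rfl
  · exact Real.arccos_nonneg _

theorem abs_lt_of_mem_D {Δ a : ℝ} (ha : a ∈ D Δ) : |a| < Real.pi - mu Δ :=
  abs_lt.2 ⟨by linarith [ha.1], ha.2⟩

theorem lt_cos_of_mem_D {Δ a : ℝ} (hΔ : Δ < 1) (ha : a ∈ D Δ) : Δ < Real.cos a := by
  by_cases h : Δ < -1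
  · exact h.trans_le (Real.neg_one_le_cos a)
  · have hcos : Real.cos (Real.pi - mu Δ) = Δ := by
      rw [Real.cos_pi_sub, mu, if_neg h, Real.cos_arccos (by linarith) (by linarith), neg_neg]
    rw [← Real.cos_abs a]
    calc Δ = Real.cos (Real.pi - mu Δ) := hcos.symm
      _ < Real.cos |a| := Real.cos_lt_cos_of_nonneg_of_le_pi (abs_nonneg a)
          (by linarith [mu_nonneg Δ]) (abs_lt_of_mem_D ha)

theorem zero_mem_D {Δ : ℝ} (hΔ : Δ < 1) : (0 : ℝ) ∈ D Δ := by
  have h : mu Δ < Real.pi := by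
    unfold mu
    split_ifs
    · exact Real.pi_pos
    · refine lt_of_le_of_ne (Real.arccos_le_pi _) fun h => ?_
      rw [Real.arccos_eq_pi] at h
      linarith
  constructor <;> linarith

theorem halfPhase_re (Δ x y : ℝ) : (halfPhase Δ x y).re =
    Real.cos ((x + y) / 2) - Δ * Real.cos ((x - y) / 2) := by
  rw [halfPhase, mul_comm Complex.I, Complex.sub_re, Complex.ofReal_re, Complex.re_ofReal_mul,
    Complex.exp_ofReal_mul_I_re]

theorem halfPhase_im (Δ x y : ℝ) : (halfPhase Δ x y).im = -(Δ * Real.sin ((x - y) / 2)) := by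
  rw [halfPhase, mul_comm Complex.I, Complex.sub_im, Complex.ofReal_im, Complex.im_ofReal_mul,
    Complex.exp_ofReal_mul_I_im, zero_sub]

theorem halfPhase_mem {Δ x y : ℝ} (hΔ : Δ < 1) (hx : x ∈ D Δ) (hy : y ∈ D Δ) :
    halfPhase Δ x y ∈ Complex.slitPlane := by
  rw [Complex.mem_slitPlane_iff, halfPhase_re, halfPhase_im]
  by_cases h0 : Δ = 0
  · left
    have hm : (x + y) / 2 ∈ D Δ := ⟨by linarith [hx.1, hy.1], by linarith [hx.2, hy.2]⟩
    have := lt_cos_of_mem_D hΔ hm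
    rw [h0] at this
    simpa [h0] using this
  · by_cases hs : Real.sin ((x - y) / 2) = 0
    · left
      have hμ := mu_nonneg Δ
      have hb : (x - y) / 2 = 0 := (Real.sin_eq_zero_iff_of_lt_of_lt
        (by linarith [hx.1, hy.2]) (by linarith [hx.2, hy.1])).1 hs
      have hxy : y = x := by linarith
      have := lt_cos_of_mem_D hΔ hx
      rw [hxy]
      simpa using this
    · right
      exact neg_ne_zero.2 (mul_ne_zero h0 hs)

theorem two_mul_halfPhase (Δ x y : ℝ) :
    2 * halfPhase Δ x y = Complex.exp (Complex.I * (((x : ℂ) - y) / 2)) * S Δ x y := by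
  have h1 : Complex.exp (Complex.I * (((x : ℂ) - y) / 2)) * Complex.exp (-(Complex.I * x)) =
      Complex.exp (-(((x : ℂ) + y) / 2) * Complex.I) := by
    rw [← Complex.exp_add]; congr 1; ring
  have h2 : Complex.exp (Complex.I * (((x : ℂ) - y) / 2)) * Complex.exp (Complex.I * y) =
      Complex.exp (((x : ℂ) + y) / 2 * Complex.I) := by
    rw [← Complex.exp_add]; congr 1; ring
  have h3 := Complex.two_cos (((x : ℂ) + y) / 2)
  rw [S, mul_sub, mul_add, h1, h2, halfPhase]
  push_cast
  rw [mul_sub, h3]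
  ring

theorem conj_halfPhase (Δ x y : ℝ) :
    (starRingEnd ℂ) (halfPhase Δ x y) = halfPhase Δ y x := by
  apply Complex.ext
  · rw [Complex.conj_re, halfPhase_re, halfPhase_re, add_comm y x,
      show (y - x) / 2 = -((x - y) / 2) by ring, Real.cos_neg]
  · rw [Complex.conj_im, halfPhase_im, halfPhase_im,
      show (y - x) / 2 = -((x - y) / 2) by ring, Real.sin_neg]
    ring

/-- An explicit function with the defining properties of `Θ`. -/
theorem isTheta_arg {Δ : ℝ} (hΔ : Δ < 1) :
    IsTheta Δ fun x y => -2 * Complex.arg (halfPhase Δ x y) where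
  continuousOn := by
    refine ContinuousOn.mul continuousOn_const fun q hq => ?_
    refine ContinuousAt.continuousWithinAt ?_
    refine ContinuousAt.comp (g := Complex.arg) (f := fun q : ℝ × ℝ => halfPhase Δ q.1 q.2)
      (Complex.continuousAt_arg (halfPhase_mem hΔ hq.1 hq.2)) ?_
    unfold halfPhase
    fun_prop
  zero := by
    have h : halfPhase Δ 0 0 = ((1 - Δ : ℝ) : ℂ) := by simp [halfPhase]
    simp only [h]
    rw [Complex.arg_ofReal_of_nonneg (by linarith)]
    simp
  exp_eq x hx y hy := by
    have hW : halfPhase Δ x y ≠ 0 := Complex.slitPlane_ne_zero (halfPhase_mem hΔ hx hy)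
    have hW' : halfPhase Δ y x ≠ 0 := Complex.slitPlane_ne_zero (halfPhase_mem hΔ hy hx)
    have e1 := two_mul_halfPhase Δ x y
    have e2 := two_mul_halfPhase Δ y x
    have hS : S Δ y x ≠ 0 := by
      intro h
      rw [h, mul_zero] at e2
      exact hW' (by simpa using e2)
    have hn : ((‖halfPhase Δ x y‖ : ℝ) : ℂ) ≠ 0 := by simpa using hW
    have hp := Complex.norm_mul_exp_arg_mul_I (halfPhase Δ x y)
    have hc := Complex.mul_conj' (halfPhase Δ x y)
    rw [conj_halfPhase] at hc
    set E := Complex.exp (Complex.arg (halfPhase Δ x y) * Complex.I) with hE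
    have hl : Complex.exp (-(Complex.I *
        ((-2 * Complex.arg (halfPhase Δ x y) : ℝ) : ℂ))) = E ^ 2 := by
      rw [hE, ← Complex.exp_nat_mul]
      congr 1
      push_cast
      ring
    have hEW : E ^ 2 * halfPhase Δ y x = halfPhase Δ x y := by
      have : E ^ 2 * halfPhase Δ y x * halfPhase Δ x y =
          halfPhase Δ x y * halfPhase Δ x y := by
        calc E ^ 2 * halfPhase Δ y x * halfPhase Δ x y
            = E ^ 2 * (halfPhase Δ x y * halfPhase Δ y x) := by ring
          _ = (‖halfPhase Δ x y‖ * E) * (‖halfPhase Δ x y‖ * E) := by rw [hc]; ring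
          _ = _ := by rw [hp]
      exact mul_right_cancel₀ hW this
    have hab : Complex.exp (Complex.I * ((x : ℂ) - y)) *
        Complex.exp (Complex.I * (((y : ℂ) - x) / 2)) =
        Complex.exp (Complex.I * (((x : ℂ) - y) / 2)) := by
      rw [← Complex.exp_add]; congr 1; ring
    have hne : Complex.exp (Complex.I * (((y : ℂ) - x) / 2)) ≠ 0 := Complex.exp_ne_zero _
    rw [hl, ← mul_div_assoc, eq_div_iff hS]
    apply mul_right_cancel₀ hne
    calc E ^ 2 * S Δ y x * Complex.exp (Complex.I * (((y : ℂ) - x) / 2))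
        = E ^ 2 * (2 * halfPhase Δ y x) := by rw [e2]; ring
      _ = 2 * (E ^ 2 * halfPhase Δ y x) := by ring
      _ = 2 * halfPhase Δ x y := by rw [hEW]
      _ = _ := by rw [e1, ← hab]; ring

theorem isTheta_theta {Δ : ℝ} (hΔ : Δ < 1) : IsTheta Δ (theta Δ) :=
  Classical.epsilon_spec ⟨_, isTheta_arg hΔ⟩

theorem IsTheta.unique {Δ : ℝ} (hΔ : Δ < 1) {Θ Θ' : ℝ → ℝ → ℝ} (h : IsTheta Δ Θ)
    (h' : IsTheta Δ Θ') {x y : ℝ} (hx : x ∈ D Δ) (hy : y ∈ D Δ) : Θ x y = Θ' x y := by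
  have hpc : IsPreconnected (D Δ ×ˢ D Δ) := isPreconnected_Ioo.prod isPreconnected_Ioo
  have hπ : (2 * Real.pi) ≠ 0 := by positivity
  have hd : DiscreteTopology (Set.range ((↑) : ℤ → ℝ)) :=
    Int.isClosedEmbedding_coe_real.isEmbedding.toHomeomorph.symm.isEmbedding.discreteTopology
  obtain ⟨v, -, hv⟩ := hpc.eqOn_const_of_mapsTo (T := Set.range ((↑) : ℤ → ℝ))
    (f := fun q : ℝ × ℝ => (Θ' q.1 q.2 - Θ q.1 q.2) / (2 * Real.pi))
    ⟨hd⟩ ((h'.continuousOn.sub h.continuousOn).div_const _)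
    (by
      rintro ⟨a, b⟩ ⟨ha, hb⟩
      have e := (h.exp_eq a ha b hb).trans (h'.exp_eq a ha b hb).symm
      obtain ⟨m, hm⟩ := Complex.exp_eq_exp_iff_exists_int.1 e
      refine ⟨m, ?_⟩
      have hm' : Complex.I * ((Θ' a b : ℂ) - Θ a b) = Complex.I * (m * (2 * Real.pi)) := by
        linear_combination hm
      have hm2 := mul_left_cancel₀ Complex.I_ne_zero hm'
      have hm3 : Θ' a b - Θ a b = m * (2 * Real.pi) := by exact_mod_cast hm2
      simp only [hm3]
      field_simp)
    ⟨0, 0, by simp⟩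
  have h0 := hv (Set.mk_mem_prod (zero_mem_D hΔ) (zero_mem_D hΔ))
  have h1 := hv (Set.mk_mem_prod hx hy)
  simp only [Function.const_apply, h.zero, h'.zero, sub_zero, zero_div] at h0 h1
  rw [← h0, div_eq_zero_iff] at h1
  rcases h1 with h1 | h1
  · linarith
  · exact absurd h1 hπ

theorem theta_unique {Δ : ℝ} (hΔ : Δ < 1) {Θ : ℝ → ℝ → ℝ} (h : IsTheta Δ Θ) {x y : ℝ}
    (hx : x ∈ D Δ) (hy : y ∈ D Δ) : Θ x y = theta Δ x y :=
  h.unique hΔ (isTheta_theta hΔ) hx hy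

/-- `L(z) = 1 + c² z / (1 - z)`, for `z ≠ 1`. -/
def L (c : ℝ) (z : ℂ) : ℂ := 1 + (c : ℂ) ^ 2 * z / (1 - z)

/-- `M(z) = 1 - c² / (1 - z)`, for `z ≠ 1`. -/
def M (c : ℝ) (z : ℂ) : ℂ := 1 - (c : ℂ) ^ 2 / (1 - z)

/-! ### Bethe's equations and the Bethe vector -/

/-- Bethe's equations
`exp(iN p_j) = (-1)^{n-1} exp(-i ∑_k Θ(p_j, p_k))` for all `j`. -/
def BetheEquations (c : ℝ) (N : ℕ) {n : ℕ} (p : Fin n → ℝ) : Prop :=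
  ∀ j : Fin n, Complex.exp (Complex.I * N * p j) =
    (-1) ^ (n - 1) *
      Complex.exp (-(Complex.I * ∑ k : Fin n, (theta (anisotropy c) (p j) (p k) : ℂ)))

/-- The amplitude
`A_σ = ε(σ) ∏_{k < l} e^{i p_{σ(k)}} S(p_{σ(k)}, p_{σ(l)})`. -/
def amplitude (c : ℝ) {n : ℕ} (p : Fin n → ℝ) (σ : Equiv.Perm (Fin n)) : ℂ :=
  ((Equiv.Perm.sign σ : ℤ) : ℂ) *
    ∏ q : Fin n × Fin n with q.1 < q.2,
      Complex.exp (Complex.I * p (σ q.1)) * S (anisotropy c) (p (σ q.1)) (p (σ q.2))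

/-- `ψ(x) = ∑_σ A_σ ∏_k exp(i p_{σ(k)} x_k)`. -/
def betheCoeff (c : ℝ) {n : ℕ} (p : Fin n → ℝ) (x : Fin n → ℕ) : ℂ :=
  ∑ σ : Equiv.Perm (Fin n), amplitude c p σ *
    ∏ k : Fin n, Complex.exp (Complex.I * p (σ k) * x k)

/-- The vector `ψ = ∑_{|x| = n} ψ(x) Ψ_x` of `Ω`. -/
def betheVector (c : ℝ) (N : ℕ) {n : ℕ} (p : Fin n → ℝ) : Finset (Fin N) → ℂ :=
  fun s => if h : s.card = n then betheCoeff c p (coord s h) else 0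

end

end SixVertex

namespace SixVertex

noncomputable section

open Finset

/-! ### Antisymmetrised products over ordered pairs -/

/-! This is the coordinate Bethe ansatz. Write `z_j = e^{ip_j}` and `s(a, b) = e^{ip_a} S(p_a,
p_b)`. A row `y` interlaced with `x` has one arrow in each gap between neighbouring arrows of `x`,
and the outer arrow lies beyond `x_n` or before `x_1`; this gives two families of rows. A gap `[a,
b]` contributes the geometric sum `L(z) z^a + M(z) z^b`. Two arrows may not share a site, and they
could only meet at the common endpoint of their gaps, so the sum over a family is a continuant
(`sum_strictMono_eq_continuant`).

Expanding the continuant gives words in left terms `l` and right terms `r`. A factor `r l` puts two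
particles at one point with coefficient `M L - 1`, once the excluded collision is subtracted. The
amplitudes are chosen so that this cancels between `σ` and `σ` composed with an adjacent
transposition (`amplitude_swap_cancel`). Only the words `l ⋯ l r ⋯ r` survive
(`sum_continuant_eq_sum_pathSum`). The pure words give `∏ L` and `∏ M`.

In each mixed word one letter belongs to a boundary gap. Moving the first particle to the last place
matches the two families up to the factor `∏ s(j, k) / s(k, j)`. The remainder then carries the
factor `scattering - z^N`, which Bethe's equations annihilate. The identity with remainder,
`mulVec_betheVector_eq`, does not assume those equations.

If `p_a = 0`, then `L(z_a)` and `M(z_a)` are singular. In the identity with remainder `p_a` is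
replaced by `t`, and `t → 0`. The poles in `∏ L + ∏ M` cancel because the Bethe equation of `a` says
`∏_{j ≠ a} L = ∏_{j ≠ a} M`. The remainder with `a` in the last place has a finite limit that
contains the derivatives of `Θ` (`tendsto_scattering_sub_pow`), and `sum_pathSum_slide` turns its
sum over permutations back into `ψ`. The rest of the remainder vanishes in the limit. -/

/-- `ε(σ) ∏_{k < l} s(σ(k), σ(l))`. -/
def orderedAmp {n : ℕ} (s : Fin n → Fin n → ℂ) (σ : Equiv.Perm (Fin n)) : ℂ :=
  ((Equiv.Perm.sign σ : ℤ) : ℂ) * ∏ q : Fin n × Fin n with q.1 < q.2, s (σ q.1) (σ q.2)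

theorem orderedAmp_mul_swap {n : ℕ} (s : Fin n → Fin n → ℂ) (σ : Equiv.Perm (Fin n))
    (i j : Fin n) (hij : (i : ℕ) + 1 = j) :
    orderedAmp s (σ * Equiv.swap i j) * s (σ i) (σ j) = -(orderedAmp s σ * s (σ j) (σ i)) := by
  have hne : i ≠ j := by rintro rfl; omega
  have hmem : (i, j) ∈ univ.filter (fun q : Fin n × Fin n => q.1 < q.2) := by
    rw [mem_filter, Fin.lt_def]
    exact ⟨mem_univ _, by simp only; omega⟩
  have key : ∏ q ∈ (univ.filter (fun q : Fin n × Fin n => q.1 < q.2)).erase (i, j),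
        s (σ (Equiv.swap i j q.1)) (σ (Equiv.swap i j q.2)) =
      ∏ q ∈ (univ.filter (fun q : Fin n × Fin n => q.1 < q.2)).erase (i, j),
        s (σ q.1) (σ q.2) := by
    -- As `i` and `j` are adjacent, the transposition preserves the order inside every pair other
    -- than `(i, j)`.
    have hmaps : ∀ q ∈ (univ.filter (fun q : Fin n × Fin n => q.1 < q.2)).erase (i, j),
        (Equiv.swap i j q.1, Equiv.swap i j q.2) ∈
          (univ.filter (fun q : Fin n × Fin n => q.1 < q.2)).erase (i, j) := by
      rintro ⟨a, b⟩ hq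
      simp only [mem_erase, ne_eq, Prod.mk.injEq, mem_filter, mem_univ, true_and,
        Equiv.swap_apply_def] at hq ⊢
      rw [Fin.lt_def] at hq
      split_ifs <;> simp only [Fin.ext_iff, Fin.lt_def] at * <;> omega
    refine prod_nbij' (fun q => (Equiv.swap i j q.1, Equiv.swap i j q.2))
      (fun q => (Equiv.swap i j q.1, Equiv.swap i j q.2)) hmaps hmaps ?_ ?_ ?_ <;> simp
  unfold orderedAmp
  rw [← mul_prod_erase _ _ hmem, ← mul_prod_erase _ (fun q => s (σ q.1) (σ q.2)) hmem]
  simp only [Equiv.Perm.coe_mul, Function.comp_apply, Equiv.swap_apply_left,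
    Equiv.swap_apply_right, Equiv.Perm.sign_mul, Equiv.Perm.sign_swap hne]
  rw [key]
  push_cast
  ring

theorem prod_lt_eq_prod_prod {n : ℕ} (F : Fin n → Fin n → ℂ) :
    ∏ q : Fin n × Fin n with q.1 < q.2, F q.1 q.2 =
      ∏ i, ∏ j, if i < j then F i j else 1 := by
  rw [prod_filter, Fintype.prod_prod_type]

theorem prod_lt_succ {m : ℕ} (F : Fin (m + 1) → Fin (m + 1) → ℂ) :
    ∏ q : Fin (m + 1) × Fin (m + 1) with q.1 < q.2, F q.1 q.2 =
      (∏ i : Fin m, F 0 i.succ) *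
        ∏ q : Fin m × Fin m with q.1 < q.2, F q.1.succ q.2.succ := by
  rw [prod_lt_eq_prod_prod, prod_lt_eq_prod_prod (fun a b => F a.succ b.succ)]
  simp [Fin.prod_univ_succ (n := m)]

theorem prod_lt_castSucc {m : ℕ} (F : Fin (m + 1) → Fin (m + 1) → ℂ) :
    ∏ q : Fin (m + 1) × Fin (m + 1) with q.1 < q.2, F q.1 q.2 =
      (∏ i : Fin m, F i.castSucc (Fin.last m)) *
        ∏ q : Fin m × Fin m with q.1 < q.2, F q.1.castSucc q.2.castSucc := by
  rw [prod_lt_eq_prod_prod, prod_lt_eq_prod_prod (fun a b => F a.castSucc b.castSucc)]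
  simp [Fin.prod_univ_castSucc (n := m), prod_mul_distrib, mul_comm,
    (Fin.castSucc_lt_last _).not_gt]

/-- The rotation sends the first particle to the last place: exactly the `m` pairs containing it are
reversed, and the sign is that of an `(m + 1)`-cycle. Denominators are cleared, so `s` may vanish.
-/
theorem orderedAmp_mul_finRotate {m : ℕ} (s : Fin (m + 1) → Fin (m + 1) → ℂ)
    (σ : Equiv.Perm (Fin (m + 1))) :
    orderedAmp s σ * ∏ j with j ≠ σ 0, s j (σ 0) =
      (-1) ^ m * (∏ j with j ≠ σ 0, s (σ 0) j) * orderedAmp s (σ * finRotate (m + 1)) := by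
  have hre : ∀ G : Fin (m + 1) → ℂ, ∏ j with j ≠ σ 0, G j = ∏ i : Fin m, G (σ i.succ) := by
    intro G
    rw [prod_filter, ← Equiv.prod_comp σ, Fin.prod_univ_succ]
    simp [Fin.succ_ne_zero]
  have hc : ∀ i : Fin m, finRotate (m + 1) i.castSucc = i.succ := by
    intro i
    rw [finRotate_apply, Fin.coeSucc_eq_succ]
  have hl : finRotate (m + 1) (Fin.last m) = 0 := finRotate_last
  unfold orderedAmp
  rw [hre, hre, prod_lt_succ (fun a b => s (σ a) (σ b)),
    prod_lt_castSucc (fun a b => s ((σ * finRotate (m + 1)) a) ((σ * finRotate (m + 1)) b))]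
  simp only [Equiv.Perm.coe_mul, Function.comp_apply, hc, hl, Equiv.Perm.sign_mul,
    sign_finRotate]
  have h1 : ((-1 : ℂ) ^ m) * (-1) ^ m = 1 := by rw [← mul_pow]; simp
  push_cast
  linear_combination (-(((Equiv.Perm.sign σ : ℤ) : ℂ) * (∏ i : Fin m, s (σ 0) (σ i.succ)) *
    (∏ q : Fin m × Fin m with q.1 < q.2, s (σ q.1.succ) (σ q.2.succ)) *
    ∏ i : Fin m, s (σ i.succ) (σ 0))) * h1

/-! ### Path sums and continuants -/

/-- `∑_{a ≤ m} l_0 ⋯ l_{a-1} r_a ⋯ r_{m-1}`. -/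
def pathSum (l r : ℕ → ℂ) : ℕ → ℂ
  | 0 => 1
  | m + 1 => pathSum l r m * r m + ∏ k ∈ range (m + 1), l k

/-- The continuant `T_{m+2} = W_{m+1} T_{m+1} - E_m T_m`. -/
def continuant (W E : ℕ → ℂ) : ℕ → ℂ
  | 0 => 1
  | 1 => W 0
  | m + 2 => W (m + 1) * continuant W E (m + 1) - E m * continuant W E m

theorem pathSum_congr {l r l' r' : ℕ → ℂ} {m : ℕ} (hl : ∀ k < m, l k = l' k)
    (hr : ∀ k < m, r k = r' k) : pathSum l r m = pathSum l' r' m := by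
  induction m with
  | zero => rfl
  | succ m ih =>
    rw [pathSum, pathSum, ih (fun k hk => hl k (by omega)) (fun k hk => hr k (by omega)),
      hr m (by omega), prod_congr rfl fun k hk => hl k (mem_range.1 hk)]

theorem continuant_congr {W E W' E' : ℕ → ℂ} (m : ℕ) (hW : ∀ k < m, W k = W' k)
    (hE : ∀ k, k + 1 < m → E k = E' k) : continuant W E m = continuant W' E' m := by
  induction m using Nat.twoStepInduction with
  | zero => rfl
  | one => exact hW 0 (by omega)
  | more m ih1 ih2 =>
    rw [continuant, continuant, hW (m + 1) (by omega), hE m (by omega),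
      ih1 (fun k hk => hW k (by omega)) (fun k hk => hE k (by omega)),
      ih2 (fun k hk => hW k (by omega)) (fun k hk => hE k (by omega))]

/-- Peels off the first letter instead of the last, which is what the family with a boundary gap
before `x_1` requires. -/
theorem pathSum_succ' (l r : ℕ → ℂ) (m : ℕ) :
    pathSum l r (m + 1) = (∏ k ∈ range (m + 1), r k) +
      l 0 * pathSum (fun k => l (k + 1)) (fun k => r (k + 1)) m := by
  induction m with
  | zero => simp [pathSum]
  | succ m ih =>
    rw [pathSum, ih, pathSum, prod_range_succ r (m + 1), prod_range_succ' l (m + 1)]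
    ring

/-- The value at the particle `σ k` in position `k`. -/
def atPos {n : ℕ} (f : ℕ → Fin n → ℂ) (σ : Equiv.Perm (Fin n)) (k : ℕ) : ℂ :=
  if h : k < n then f k (σ ⟨k, h⟩) else 0

theorem atPos_of_lt {n : ℕ} (f : ℕ → Fin n → ℂ) (σ : Equiv.Perm (Fin n)) {k : ℕ} (h : k < n) :
    atPos f σ k = f k (σ ⟨k, h⟩) := dif_pos h

theorem atPos_congr {n : ℕ} (f : ℕ → Fin n → ℂ) {σ τ : Equiv.Perm (Fin n)} {k : ℕ}
    (h : ∀ i : Fin n, (i : ℕ) = k → σ i = τ i) : atPos f σ k = atPos f τ k := by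
  unfold atPos
  split_ifs with hk
  · rw [h _ rfl]
  · rfl

theorem prod_range_atPos {n : ℕ} (f : ℕ → Fin n → ℂ) (σ : Equiv.Perm (Fin n)) :
    ∏ k ∈ range n, atPos f σ k = ∏ k : Fin n, f k (σ k) := by
  rw [← Fin.prod_univ_eq_prod_range (atPos f σ)]
  exact prod_congr rfl fun k _ => atPos_of_lt f σ k.2

/-- The products `e_k(σ(k)) e_k(σ(k+1))`. -/
def pairAt {n : ℕ} (e : ℕ → Fin n → ℂ) (σ : Equiv.Perm (Fin n)) (k : ℕ) : ℂ :=
  atPos e σ k * atPos (fun i => e (i - 1)) σ (k + 1)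

/-- `h σ` depends only on the `σ k` with `m ≤ k`. -/
def DependsFrom {n : ℕ} (m : ℕ) (h : Equiv.Perm (Fin n) → ℂ) : Prop :=
  ∀ σ τ : Equiv.Perm (Fin n), (∀ k : Fin n, m ≤ (k : ℕ) → σ k = τ k) → h σ = h τ

theorem DependsFrom.mono {n : ℕ} {m m' : ℕ} {h : Equiv.Perm (Fin n) → ℂ} (hh : DependsFrom m h)
    (hm : m' ≤ m) : DependsFrom m' h :=
  fun σ τ hst => hh σ τ fun k hk => hst k (hm.trans hk)

theorem DependsFrom.mul {n : ℕ} {m : ℕ} {h g : Equiv.Perm (Fin n) → ℂ} (hh : DependsFrom m h)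
    (hg : DependsFrom m g) : DependsFrom m fun σ => h σ * g σ :=
  fun σ τ hst => by simp only [hh σ τ hst, hg σ τ hst]

theorem dependsFrom_atPos {n : ℕ} (f : ℕ → Fin n → ℂ) {m k : ℕ} (hk : m ≤ k) :
    DependsFrom m fun σ : Equiv.Perm (Fin n) => atPos f σ k :=
  fun _ _ hst => atPos_congr f fun i hi => hst i (hi ▸ hk)

theorem pathSum_atPos_mul_swap {n : ℕ} (l r : ℕ → Fin n → ℂ) (σ : Equiv.Perm (Fin n))
    {i j : Fin n} {m : ℕ} (hi : m ≤ i) (hj : m ≤ j) :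
    pathSum (atPos l (σ * Equiv.swap i j)) (atPos r (σ * Equiv.swap i j)) m =
      pathSum (atPos l σ) (atPos r σ) m := by
  have : ∀ k < m, ∀ a : Fin n, (a : ℕ) = k → (σ * Equiv.swap i j) a = σ a := by
    rintro k hk a rfl
    rw [Equiv.Perm.mul_apply, Equiv.swap_apply_of_ne_of_ne] <;> rintro rfl <;> omega
  exact pathSum_congr (fun k hk => atPos_congr l (this k hk))
    (fun k hk => atPos_congr r (this k hk))

/-- By the two recursions, the step from `m + 1` to `m + 2` leaves the defect `pathSum m * (r_m
l_{m+1} - e_m e_m)`. The weight `h` sees only later places, so this defect is antisymmetric under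
exchanging the places `m` and `m + 1`, by `hA`. -/
theorem sum_continuant_eq_sum_pathSum {n : ℕ} (A : Equiv.Perm (Fin n) → ℂ)
    (l r e : ℕ → Fin n → ℂ)
    (hA : ∀ (σ : Equiv.Perm (Fin n)) (i j : Fin n), (i : ℕ) + 1 = j →
      A σ * (r i (σ i) * l j (σ j) - e i (σ i) * e i (σ j)) +
        A (σ * Equiv.swap i j) * (r i (σ j) * l j (σ i) - e i (σ i) * e i (σ j)) = 0)
    (m : ℕ) (hm : m ≤ n) (h : Equiv.Perm (Fin n) → ℂ) (hh : DependsFrom m h) :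
    ∑ σ, A σ * continuant (fun k => atPos l σ k + atPos r σ k) (pairAt e σ) m * h σ =
      ∑ σ, A σ * pathSum (atPos l σ) (atPos r σ) m * h σ := by
  induction m using Nat.twoStepInduction generalizing h with
  | zero => rfl
  | one =>
    refine sum_congr rfl fun σ _ => ?_
    simp only [continuant, pathSum, prod_range_one, zero_add]
    ring
  | more m ih1 ih2 =>
    have e1 := ih2 (by omega) (fun σ => (atPos l σ (m + 1) + atPos r σ (m + 1)) * h σ)
      (DependsFrom.mul (fun σ τ hst => by
        simp only [dependsFrom_atPos l le_rfl σ τ hst, dependsFrom_atPos r le_rfl σ τ hst])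
        (hh.mono (by omega)))
    have e2 := ih1 (by omega) (fun σ => pairAt e σ m * h σ)
      (DependsFrom.mul (DependsFrom.mul (dependsFrom_atPos _ le_rfl)
        (dependsFrom_atPos _ (by omega))) (hh.mono (by omega)))
    set i : Fin n := ⟨m, by omega⟩ with hi
    set j : Fin n := ⟨m + 1, by omega⟩ with hj
    -- The defect of the recursion; its sum is killed by pairing `σ` with `σ * swap i j`.
    set g : Equiv.Perm (Fin n) → ℂ := fun σ =>
      A σ * (r m (σ i) * l (m + 1) (σ j) - e m (σ i) * e m (σ j)) *
        (pathSum (atPos l σ) (atPos r σ) m * h σ) with hg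
    have hsum : ∑ σ, g σ = 0 := by
      have hs : ∑ σ, g (σ * Equiv.swap i j) = ∑ σ, g σ :=
        Equiv.sum_comp (Equiv.mulRight (Equiv.swap i j)) g
      have h0 : ∑ σ, (g σ + g (σ * Equiv.swap i j)) = 0 := by
        refine sum_eq_zero fun σ _ => ?_
        have hhs : h (σ * Equiv.swap i j) = h σ := hh _ _ fun k hk => by
          rw [Equiv.Perm.mul_apply, Equiv.swap_apply_of_ne_of_ne] <;> rintro rfl <;>
            simp [hi, hj] at hk
        simp only [hg]
        rw [hhs, pathSum_atPos_mul_swap l r σ (by simp [hi]) (by simp [hj])]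
        simp only [Equiv.Perm.mul_apply, Equiv.swap_apply_left, Equiv.swap_apply_right]
        linear_combination (pathSum (atPos l σ) (atPos r σ) m * h σ) * hA σ i j rfl
      rw [sum_add_distrib, hs] at h0
      linear_combination h0 / 2
    have hL : ∑ σ, A σ * continuant (fun k => atPos l σ k + atPos r σ k) (pairAt e σ) (m + 2) *
        h σ = ∑ σ, A σ * continuant (fun k => atPos l σ k + atPos r σ k) (pairAt e σ) (m + 1) *
          ((atPos l σ (m + 1) + atPos r σ (m + 1)) * h σ) -
        ∑ σ, A σ * continuant (fun k => atPos l σ k + atPos r σ k) (pairAt e σ) m *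
          (pairAt e σ m * h σ) := by
      rw [← sum_sub_distrib]
      refine sum_congr rfl fun σ _ => ?_
      rw [continuant]
      ring
    rw [hL, e1, e2, ← sum_sub_distrib, ← sub_eq_zero, ← sum_sub_distrib, ← hsum]
    refine sum_congr rfl fun σ _ => ?_
    have hl1 : l (m + 1) (σ j) = atPos l σ (m + 1) := (atPos_of_lt l σ (by omega)).symm
    have hr1 : r m (σ i) = atPos r σ m := (atPos_of_lt r σ (by omega)).symm
    have he : e m (σ i) * e m (σ j) = pairAt e σ m := by
      rw [pairAt, atPos_of_lt e σ (show m < n by omega),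
        atPos_of_lt _ σ (show m + 1 < n by omega)]
      rfl
    simp only [hg]
    have h1 : pathSum (atPos l σ) (atPos r σ) (m + 1) =
      pathSum (atPos l σ) (atPos r σ) m * atPos r σ m + ∏ k ∈ range (m + 1), atPos l σ k := rfl
    have h2 : pathSum (atPos l σ) (atPos r σ) (m + 2) =
      pathSum (atPos l σ) (atPos r σ) (m + 1) * atPos r σ (m + 1) +
        ∏ k ∈ range (m + 2), atPos l σ k := rfl
    rw [hl1, hr1, he, h2, prod_range_succ _ (m + 1)]
    linear_combination A σ * h σ * atPos l σ (m + 1) * h1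

/-! ### Sums over strictly increasing sequences -/

/-- The weighted sum over strictly increasing `y_0 < ⋯ < y_m` with `y_m = v`. -/
def endSum {N : ℕ} (w : ℕ → Fin N → ℂ) : ℕ → Fin N → ℂ
  | 0, v => w 0 v
  | m + 1, v => w (m + 1) v * ∑ u with u < v, endSum w m u

theorem strictMono_snoc_iff {N m : ℕ} (y : Fin (m + 1) → Fin N) (v : Fin N) :
    StrictMono (Fin.snoc y v : Fin (m + 2) → Fin N) ↔ StrictMono y ∧ y (Fin.last m) < v := by
  rw [Fin.strictMono_iff_lt_succ, Fin.strictMono_iff_lt_succ, Fin.forall_fin_succ']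
  simp only [Fin.snoc_castSucc, Fin.succ_last, Fin.snoc_last, Fin.succ_castSucc]

theorem sum_strictMono_last {N : ℕ} (w : ℕ → Fin N → ℂ) (m : ℕ) (v : Fin N) :
    ∑ y : Fin (m + 1) → Fin N with StrictMono y ∧ y (Fin.last m) = v, ∏ k : Fin (m + 1), w k (y k) =
      endSum w m v := by
  induction m generalizing v with
  | zero =>
    rw [sum_eq_single_of_mem (fun _ => v)]
    · simp [endSum]
    · simp [Subsingleton.strictMono]
    · intro y hy hne
      refine absurd (funext fun k => ?_) hne
      rw [show k = Fin.last 0 from Subsingleton.elim (α := Fin 1) k _]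
      exact (mem_filter.1 hy).2.2
  | succ m ih =>
    rw [endSum, sum_filter, ← Equiv.sum_comp (Fin.snocEquiv fun _ => Fin N),
      Fintype.sum_prod_type]
    have hsm : ∀ (u : Fin N) (y : Fin (m + 1) → Fin N),
        StrictMono ((Fin.snocEquiv fun _ => Fin N) (u, y)) ↔ StrictMono y ∧ y (Fin.last m) < u :=
      fun u y => strictMono_snoc_iff y u
    simp only [hsm]
    simp only [Fin.snocEquiv_apply, Fin.snoc_last]
    rw [sum_eq_single v]
    · simp only [and_true, Fin.prod_univ_castSucc (n := m + 1), Fin.snoc_castSucc, Fin.snoc_last,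
        Fin.val_castSucc, Fin.val_last]
      rw [← sum_filter, ← sum_mul, mul_comm]
      congr 1
      rw [← sum_fiberwise_of_maps_to (g := fun y : Fin (m + 1) → Fin N => y (Fin.last m))
        (t := univ.filter (· < v)) (by simp)]
      refine sum_congr rfl fun u hu => ?_
      rw [← ih u, filter_filter]
      refine sum_congr (filter_congr fun y _ => ?_) fun _ _ => rfl
      have : u < v := (mem_filter.1 hu).2
      constructor
      · rintro ⟨⟨h1, -⟩, h2⟩
        exact ⟨h1, h2⟩
      · rintro ⟨h1, h2⟩
        exact ⟨⟨h1, h2 ▸ this⟩, h2⟩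
    · intro u _ hu
      simp [hu]
    · simp

/-- Where the weights are non-zero, `y_m ≤ q_m ≤ y_{m+1}`, so strict increase fails only through
`y_m = y_{m+1} = q_m`. Removing this collision subtracts `E_m`; as `q_m < q_{m+1}`, two consecutive
collisions cannot occur. -/
theorem sum_strictMono_eq_continuant {N : ℕ} (w : ℕ → Fin N → ℂ) (q : ℕ → Fin N) (n : ℕ)
    (h1 : ∀ m, m + 1 < n → ∀ v, w m v ≠ 0 → v ≤ q m)
    (h2 : ∀ m, m + 1 < n → ∀ v, w (m + 1) v ≠ 0 → q m ≤ v)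
    (h3 : ∀ m, m + 2 < n → q m < q (m + 1)) :
    ∑ y : Fin n → Fin N with StrictMono y, ∏ k : Fin n, w k (y k) =
      continuant (fun k => ∑ v, w k v) (fun k => w k (q k) * w (k + 1) (q k)) n := by
  set W : ℕ → ℂ := fun k => ∑ v, w k v
  set E : ℕ → ℂ := fun k => w k (q k) * w (k + 1) (q k)
  have hle : ∀ m, m + 1 < n → ∀ v, endSum w m v ≠ 0 → v ≤ q m := by
    intro m hm v hv
    apply h1 m hm
    cases m with
    | zero => exact hv
    | succ m => exact left_ne_zero_of_mul hv
  have hall : ∀ m, m + 1 < n → ∀ v, q m < v →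
      ∑ u with u < v, endSum w m u = ∑ u, endSum w m u := by
    intro m hm v hv
    refine sum_filter_of_ne fun u _ hu => (hle m hm u hu).trans_lt hv
  have main : ∀ m, m < n → ∑ v, endSum w m v = continuant W E (m + 1) ∧
      (m + 1 < n → endSum w m (q m) = w m (q m) * continuant W E m) := by
    intro m
    induction m with
    | zero => exact fun _ => ⟨rfl, fun _ => (mul_one _).symm⟩
    | succ m ih =>
      intro hm
      obtain ⟨ih1, ih2⟩ := ih (by omega)
      refine ⟨?_, fun hm' => ?_⟩
      -- The constraint `u < v` removes something from the support only at `v = q m`, and there it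
      -- removes the single value `u = q m`.
      · have hterm : ∀ v, endSum w (m + 1) v = w (m + 1) v * continuant W E (m + 1) -
            if v = q m then E m * continuant W E m else 0 := by
          intro v
          rw [endSum]
          by_cases hw : w (m + 1) v = 0
          · split_ifs with hv
            · subst hv
              simp [E, hw]
            · simp [hw]
          rcases (h2 m hm v hw).lt_or_eq with hlt | heq
          · rw [hall m hm v hlt, ih1, if_neg hlt.ne', sub_zero]
          · rw [if_pos heq.symm]
            have hs : ∑ u with u < v, endSum w m u = ∑ u, endSum w m u - endSum w m (q m) := by
              rw [eq_sub_iff_add_eq, ← sum_filter_add_sum_filter_not univ (· < v)]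
              congr 1
              rw [sum_eq_single_of_mem (q m) (by simp [heq])]
              intro u hu hne
              by_contra h0
              have := hle m hm u h0
              simp only [mem_filter, mem_univ, true_and, not_lt] at hu
              exact hne (le_antisymm this (heq ▸ hu))
            rw [hs, ih1, ih2 hm, ← heq]
            simp only [E]
            ring
        rw [sum_congr rfl fun v _ => hterm v, sum_sub_distrib, ← sum_mul, sum_ite_eq',
          if_pos (mem_univ _), continuant]
      · rw [endSum, hall m hm _ (h3 m hm'), ih1]
  cases n with
  | zero => simp [continuant, Subsingleton.strictMono]
  | succ n =>
    rw [← (main n (by omega)).1, ← sum_congr rfl fun v _ => sum_strictMono_last w n v,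
      ← sum_fiberwise _ (fun y : Fin (n + 1) → Fin N => y (Fin.last n))]
    exact sum_congr rfl fun v _ => by rw [filter_filter]

/-- Summation over the `n`-element sets of sites is summation over increasing sequences. -/
theorem sum_card_eq_sum_strictMono {N n : ℕ} (G : (Fin n → Fin N) → ℂ) :
    ∑ t : Finset (Fin N), (if h : t.card = n then G (t.orderEmbOfFin h) else 0) =
      ∑ y : Fin n → Fin N with StrictMono y, G y := by
  rw [← sum_filter_of_ne (p := fun t : Finset (Fin N) => t.card = n)
    (fun t _ ht => by by_contra h; simp [h] at ht)]
  refine sum_bij (fun t ht => t.orderEmbOfFin (mem_filter.1 ht).2) ?_ ?_ ?_ ?_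
  · intro t ht
    simp [(t.orderEmbOfFin _).strictMono]
  · intro t ht t' ht' h
    have := congrArg Set.range h
    simpa using this
  · intro y hy
    have hy' : StrictMono y := (mem_filter.1 hy).2
    have hc : (univ.image y).card = n := by
      rw [card_image_of_injective _ hy'.injective, card_univ, Fintype.card_fin]
    refine ⟨univ.image y, by simpa using hc, ?_⟩
    exact (orderEmbOfFin_unique hc (fun k => mem_image_of_mem _ (mem_univ k)) hy').symm
  · intro t ht
    rw [dif_pos]

/-! ### Weights of the interlaced rows -/

/-- The points `0 < x_1 < ⋯ < x_n < N + 1 < N + 2 < ⋯`. -/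
def gridPoint {N n : ℕ} (x : Fin n → Fin N) : ℕ → ℕ
  | 0 => 0
  | k + 1 => if h : k < n then (x ⟨k, h⟩ : ℕ) + 1 else N + 1 + (k - n)

theorem gridPoint_succ {N n : ℕ} (x : Fin n → Fin N) (k : Fin n) :
    gridPoint x (k + 1) = (x k : ℕ) + 1 := by
  simp [gridPoint]

theorem gridPoint_last {N n : ℕ} (x : Fin n → Fin N) : gridPoint x (n + 1) = N + 1 := by
  simp [gridPoint]

/-- The values beyond `N + 1` exist for this: grid points compare as their indices do, without range
conditions. -/
theorem gridPoint_strictMono {N n : ℕ} {x : Fin n → Fin N} (hx : StrictMono x) :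
    StrictMono (gridPoint x) := by
  refine strictMono_nat_of_lt_succ fun k => ?_
  rcases k with _ | k
  · simp only [gridPoint]
    split_ifs <;> omega
  · simp only [gridPoint]
    split_ifs with h1 h2 h2
    · have : x ⟨k, h1⟩ < x ⟨k + 1, h2⟩ := hx (by simp [Fin.lt_def])
      rw [Fin.lt_def] at this
      omega
    · have := (x ⟨k, h1⟩).2
      omega
    · omega
    · omega

/-- The weight of the position `v` of an arrow in the gap `[a, b]` between two arrows of the
adjacent row. -/
def gapWeight (c : ℝ) (a b v : ℕ) : ℂ :=
  if a ≤ v ∧ v ≤ b then (if v = a ∨ v = b then 1 else (c : ℂ) ^ 2) else 0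

/-- The weight is the constant `c²` with `1 - c²` added at both ends; the rest is a geometric sum.
-/
theorem sum_Icc_gapWeight (c : ℝ) {a b : ℕ} (hab : a < b) {z : ℂ} (hz : z ≠ 1) :
    ∑ u ∈ Icc a b, gapWeight c a b u * z ^ u = L c z * z ^ a + M c z * z ^ b := by
  have h1 : ∀ u ∈ Icc a b, gapWeight c a b u * z ^ u = (c : ℂ) ^ 2 * z ^ u +
      (if u = a then (1 - (c : ℂ) ^ 2) * z ^ a else 0) +
      (if u = b then (1 - (c : ℂ) ^ 2) * z ^ b else 0) := by
    intro u hu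
    rw [gapWeight, if_pos (mem_Icc.1 hu)]
    by_cases ha : u = a
    · subst ha
      rw [if_pos (Or.inl rfl), if_pos rfl, if_neg hab.ne]
      ring
    · by_cases hb : u = b
      · subst hb
        rw [if_pos (Or.inr rfl), if_neg ha, if_pos rfl]
        ring
      · rw [if_neg (by tauto), if_neg ha, if_neg hb]
        ring
  rw [sum_congr rfl h1, sum_add_distrib, sum_add_distrib, sum_ite_eq', sum_ite_eq',
    if_pos (left_mem_Icc.2 hab.le), if_pos (right_mem_Icc.2 hab.le), ← mul_sum,
    show Icc a b = Ico a (b + 1) from rfl, geom_sum_Ico hz (by omega), L, M]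
  have hz1 : z - 1 ≠ 0 := sub_ne_zero.2 hz
  have hz2 : 1 - z ≠ 0 := sub_ne_zero.2 hz.symm
  rw [show z - 1 = -(1 - z) by ring]
  field_simp
  ring

/-- The outer gaps end at `0` and `N + 1`, which are not sites. Their endpoint contributions, of
weight 1, must be taken out of the geometric sum; this is the origin of the two corrections `- 1`.
-/
theorem sum_gapWeight (c : ℝ) {N n : ℕ} {x : Fin n → Fin N} (hx : StrictMono x) {z : ℂ}
    (hz : z ≠ 1) {k : ℕ} (hk : k ≤ n) :
    ∑ v : Fin N, gapWeight c (gridPoint x k) (gridPoint x (k + 1)) (v + 1) * z ^ (v + 1 : ℕ) =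
      (L c z - if k = 0 then 1 else 0) * z ^ gridPoint x k +
        (M c z - if k = n then 1 else 0) * z ^ gridPoint x (k + 1) := by
  have hX := gridPoint_strictMono hx
  have hlt : gridPoint x k < gridPoint x (k + 1) := hX (by omega)
  have hle : gridPoint x (k + 1) ≤ N + 1 := by
    rw [← gridPoint_last x]
    exact hX.monotone (by omega)
  set a := gridPoint x k
  set b := gridPoint x (k + 1)
  have ha : a = 0 ↔ k = 0 := by
    rw [show (0 : ℕ) = gridPoint x 0 from rfl]
    exact hX.injective.eq_iff
  have hb : b = N + 1 ↔ k = n := by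
    rw [← gridPoint_last x]
    exact hX.injective.eq_iff.trans (by omega)
  set F : ℕ → ℂ := fun u => gapWeight c a b u * z ^ u with hF
  have hsum : ∑ u ∈ range (N + 2), F u = ∑ u ∈ Icc a b, F u := by
    symm
    refine sum_subset (fun u hu => ?_) fun u _ hu => ?_
    · rw [mem_Icc] at hu
      rw [mem_range]
      omega
    · rw [mem_Icc] at hu
      simp [hF, gapWeight, hu]
  have h0 : F 0 = if k = 0 then 1 else 0 := by
    by_cases h : k = 0
    · have := ha.2 h
      simp [hF, gapWeight, h, this]
    · have : ¬ a = 0 := fun h' => h (ha.1 h')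
      simp [hF, gapWeight, h, this]
  have h1 : F (N + 1) = (if k = n then 1 else 0) * z ^ b := by
    by_cases h : k = n
    · have hb' := hb.2 h
      have : a ≤ N + 1 := by omega
      simp [hF, gapWeight, h, hb', this]
    · have : ¬ N + 1 ≤ b := fun h' => h (hb.1 (by omega))
      simp [hF, gapWeight, h, this]
  have h2 : (if k = 0 then (1 : ℂ) else 0) * z ^ a = if k = 0 then 1 else 0 := by
    split_ifs with h
    · rw [ha.2 h]
      simp
    · simp
  have h3 := sum_Icc_gapWeight c hlt hz
  rw [sum_range_succ, sum_range_succ', Finset.sum_range, h0, h1] at hsum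
  linear_combination hsum + h3 + h2

/-- No arrow of `x` lies strictly between consecutive grid points, and the virtual endpoints are
never occupied, so a site of the gap is an endpoint exactly when it belongs to `x`. -/
theorem gapWeight_gridPoint (c : ℝ) {N n : ℕ} {x : Fin n → Fin N} (hx : StrictMono x)
    (k : ℕ) (v : Fin N) :
    gapWeight c (gridPoint x k) (gridPoint x (k + 1)) (v + 1) =
      if gridPoint x k ≤ v + 1 ∧ (v + 1 : ℕ) ≤ gridPoint x (k + 1) then
        (if v ∈ Set.range x then 1 else (c : ℂ) ^ 2) else 0 := by
  have hX := gridPoint_strictMono hx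
  unfold gapWeight
  split_ifs with h h1 h2 h2
  · rfl
  · exfalso
    have hmem : ∀ a, (v + 1 : ℕ) = gridPoint x a → v ∈ Set.range x := by
      intro a ha
      rcases a with _ | a
      · simp [gridPoint] at ha
      · rw [gridPoint] at ha
        split_ifs at ha with h'
        · exact ⟨⟨a, h'⟩, Fin.ext (by omega)⟩
        · have := v.2
          omega
    exact h1.elim (fun h => h2 (hmem _ h)) (fun h => h2 (hmem _ h))
  · exfalso
    obtain ⟨i, rfl⟩ := h2
    rw [← gridPoint_succ] at h h1
    have e1 := hX.le_iff_le.1 h.1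
    have e2 := hX.le_iff_le.1 h.2
    rw [hX.injective.eq_iff, hX.injective.eq_iff] at h1
    omega
  · rfl
  · rfl

theorem prod_gapWeight_right (c : ℝ) {N n : ℕ} {x : Fin n → Fin N} (hx : StrictMono x)
    (y : Fin n → Fin N) [Decidable (Chain (fun k => (x k : ℕ) + 1) fun k => (y k : ℕ) + 1)] :
    ∏ k : Fin n, gapWeight c (gridPoint x (k + 1)) (gridPoint x (k + 2)) (y k + 1) =
      if Chain (fun k => (x k : ℕ) + 1) fun k => (y k : ℕ) + 1 then
        ∏ k, (if y k ∈ Set.range x then 1 else (c : ℂ) ^ 2) else 0 := by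
  simp only [gapWeight_gridPoint c hx, prod_ite_zero]
  have hiff : (∀ k ∈ (univ : Finset (Fin n)), gridPoint x (k + 1) ≤ y k + 1 ∧
      (y k + 1 : ℕ) ≤ gridPoint x (k + 2)) ↔
      Chain (fun k => (x k : ℕ) + 1) fun k => (y k : ℕ) + 1 := by
    simp only [Chain, mem_univ, true_imp_iff, gridPoint_succ, forall_and]
    refine and_congr Iff.rfl ⟨fun h k l hkl => ?_, fun h k => ?_⟩
    · have := h k
      rw [show (k : ℕ) + 2 = l + 1 by omega, gridPoint_succ] at this
      exact this
    · rw [gridPoint]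
      split_ifs with hk
      · exact h k ⟨k + 1, hk⟩ rfl
      · have := (y k).2
        omega
  by_cases hC : Chain (fun k => (x k : ℕ) + 1) fun k => (y k : ℕ) + 1
  · rw [if_pos (hiff.2 hC), if_pos hC]
  · rw [if_neg (fun h => hC (hiff.1 h)), if_neg hC]

theorem prod_gapWeight_left (c : ℝ) {N n : ℕ} {x : Fin n → Fin N} (hx : StrictMono x)
    (y : Fin n → Fin N) [Decidable (Chain (fun k => (y k : ℕ) + 1) fun k => (x k : ℕ) + 1)] :
    ∏ k : Fin n, gapWeight c (gridPoint x k) (gridPoint x (k + 1)) (y k + 1) =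
      if Chain (fun k => (y k : ℕ) + 1) fun k => (x k : ℕ) + 1 then
        ∏ k, (if y k ∈ Set.range x then 1 else (c : ℂ) ^ 2) else 0 := by
  simp only [gapWeight_gridPoint c hx, prod_ite_zero]
  have hiff : (∀ k ∈ (univ : Finset (Fin n)), gridPoint x k ≤ y k + 1 ∧
      (y k + 1 : ℕ) ≤ gridPoint x (k + 1)) ↔
      Chain (fun k => (y k : ℕ) + 1) fun k => (x k : ℕ) + 1 := by
    simp only [Chain, mem_univ, true_imp_iff, gridPoint_succ, forall_and]
    rw [and_comm]
    refine and_congr Iff.rfl ⟨fun h k l hkl => ?_, fun h k => ?_⟩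
    · have := h l
      rw [← hkl, gridPoint_succ] at this
      exact this
    · obtain ⟨k, hk⟩ := k
      rcases k with _ | k
      · simp [gridPoint]
      · have := h ⟨k, by omega⟩ ⟨k + 1, hk⟩ rfl
        rw [← gridPoint_succ] at this
        exact this
  by_cases hC : Chain (fun k => (y k : ℕ) + 1) fun k => (x k : ℕ) + 1
  · rw [if_pos (hiff.2 hC), if_pos hC]
  · rw [if_neg (fun h => hC (hiff.1 h)), if_neg hC]

/-- Equal cardinalities make the two set differences equally large, so each arrow of `t` outside `s`
accounts for two differing sites, hence for `c²`. -/
theorem pow_diffCount (c : ℝ) {N n : ℕ} {s t : Finset (Fin N)} (hs : s.card = n)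
    (ht : t.card = n) :
    ((c ^ diffCount s t : ℝ) : ℂ) = ∏ k : Fin n,
      (if t.orderEmbOfFin ht k ∈ Set.range (s.orderEmbOfFin hs) then 1 else (c : ℂ) ^ 2) := by
  have hd : diffCount s t = 2 * (t \ s).card := by
    have h1 : (univ.filter fun i : Fin N => spin s i ≠ spin t i) = (s \ t) ∪ (t \ s) := by
      ext i
      rw [mem_filter]
      simp only [spin, mem_univ, true_and, mem_union, mem_sdiff]
      by_cases h1 : i ∈ s <;> by_cases h2 : i ∈ t <;> simp [h1, h2]
    have h2 : (s \ t).card = (t \ s).card := card_sdiff_comm (hs.trans ht.symm)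
    rw [diffCount, h1, card_union_of_disjoint (disjoint_sdiff_sdiff), h2]
    omega
  have himg : ∏ k : Fin n, (if t.orderEmbOfFin ht k ∈ s then 1 else (c : ℂ) ^ 2) =
      ∏ i ∈ t, (if i ∈ s then 1 else (c : ℂ) ^ 2) := by
    calc _ = ∏ i ∈ univ.image (t.orderEmbOfFin ht), (if i ∈ s then 1 else (c : ℂ) ^ 2) :=
          (prod_image fun _ _ _ _ h => (t.orderEmbOfFin ht).injective h).symm
      _ = _ := by rw [image_orderEmbOfFin_univ]
  have hr : ∀ v, v ∈ Set.range (s.orderEmbOfFin hs) ↔ v ∈ s := by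
    intro v
    rw [range_orderEmbOfFin, mem_coe]
  simp only [hr]
  rw [himg, prod_ite, prod_const_one, one_mul, prod_const, hd, pow_mul, sdiff_eq_filter]
  push_cast
  rfl

theorem Chain.antisymm {n : ℕ} {x y : Fin n → ℕ} (h : Chain x y) (h' : Chain y x) : x = y :=
  funext fun k => le_antisymm (h.1 k) (h'.1 k)

theorem eq_of_coord_eq {N n : ℕ} {s t : Finset (Fin N)} (hs : s.card = n) (ht : t.card = n)
    (h : coord s hs = coord t ht) : s = t := by
  rw [← coe_inj, ← range_orderEmbOfFin s hs, ← range_orderEmbOfFin t ht]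
  congr 1
  funext k
  have := congrFun h k
  simp only [coord] at this
  exact Fin.ext (by omega)

-- The diagonal entry 2 is one unit from each chain condition. Off the diagonal at most one of them
-- holds, so the two interlacing families may be summed separately.
open Classical in
theorem transferMatrix_apply (c : ℝ) {N n : ℕ} {s t : Finset (Fin N)} (hs : s.card = n)
    (ht : t.card = n) :
    transferMatrix N c s t =
      (if Chain (coord s hs) (coord t ht) then c ^ diffCount s t else 0) +
        if Chain (coord t ht) (coord s hs) then c ^ diffCount s t else 0 := by
  have hI : Interlaced s t ↔
      Chain (coord s hs) (coord t ht) ∨ Chain (coord t ht) (coord s hs) := by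
    constructor
    · rintro ⟨n', hs', ht', h⟩
      subst hs
      subst hs'
      exact h
    · exact fun h => ⟨n, hs, ht, h⟩
  rw [transferMatrix, Matrix.of_apply]
  by_cases h : s = t
  · subst h
    have hC : Chain (coord s hs) (coord s hs) :=
      ⟨fun _ => le_rfl, fun k l hkl => by
        have : s.orderEmbOfFin hs k < s.orderEmbOfFin hs l :=
          (s.orderEmbOfFin hs).strictMono (by rw [Fin.lt_def]; omega)
        rw [Fin.lt_def] at this
        simp only [coord]
        omega⟩
    have hd : diffCount s s = 0 := by simp [diffCount]
    rw [if_pos rfl, if_pos hC, hd]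
    norm_num
  · rw [if_neg h]
    by_cases h1 : Chain (coord s hs) (coord t ht)
    · have h2 : ¬ Chain (coord t ht) (coord s hs) := fun h2 =>
        h (eq_of_coord_eq hs ht (h1.antisymm h2))
      rw [if_pos (hI.2 (Or.inl h1)), if_pos h1, if_neg h2, add_zero]
    · by_cases h2 : Chain (coord t ht) (coord s hs)
      · rw [if_pos (hI.2 (Or.inr h2)), if_neg h1, if_pos h2, zero_add]
      · rw [if_neg (fun h => (hI.1 h).elim h1 h2), if_neg h1, if_neg h2, add_zero]

/-! ### The action of the transfer matrix on a Bethe vector -/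

/-- `e^{i p_a} S(p_a, p_b)`. -/
def pairFactor (c : ℝ) {n : ℕ} (p : Fin n → ℝ) (a b : Fin n) : ℂ :=
  Complex.exp (Complex.I * p a) * S (anisotropy c) (p a) (p b)

/-- `e^{i p_j}`. -/
def fugacity {n : ℕ} (p : Fin n → ℝ) (j : Fin n) : ℂ := Complex.exp (Complex.I * p j)

theorem amplitude_eq_orderedAmp (c : ℝ) {n : ℕ} (p : Fin n → ℝ) (σ : Equiv.Perm (Fin n)) :
    amplitude c p σ = orderedAmp (pairFactor c p) σ := rfl

theorem pairFactor_eq (c : ℝ) {n : ℕ} (p : Fin n → ℝ) (a b : Fin n) :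
    pairFactor c p a b =
      1 + fugacity p a * fugacity p b - (2 - (c : ℂ) ^ 2) * fugacity p a := by
  have h : Complex.exp (Complex.I * p a) * Complex.exp (-(Complex.I * p a)) = 1 := by
    rw [← Complex.exp_add, add_neg_cancel, Complex.exp_zero]
  rw [pairFactor, S, fugacity, fugacity, anisotropy]
  push_cast
  linear_combination h

theorem betheCoeff_eq (c : ℝ) {n : ℕ} (p : Fin n → ℝ) (x : Fin n → ℕ) :
    betheCoeff c p x = ∑ σ : Equiv.Perm (Fin n), amplitude c p σ *
      ∏ k : Fin n, fugacity p (σ k) ^ x k := by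
  refine sum_congr rfl fun σ _ => ?_
  congr 1
  refine prod_congr rfl fun k _ => ?_
  rw [fugacity, ← Complex.exp_nat_mul]
  congr 1
  ring

theorem mulVec_betheVector_of_card_ne (c : ℝ) {N n : ℕ} (p : Fin n → ℝ) {s : Finset (Fin N)}
    (hs : s.card ≠ n) :
    ((transferMatrix N c).map Complex.ofReal).mulVec (betheVector c N p) s = 0 := by
  rw [Matrix.mulVec, dotProduct]
  refine sum_eq_zero fun t _ => ?_
  rw [betheVector]
  split_ifs with ht
  · have h1 : s ≠ t := by
      rintro rfl
      exact hs ht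
    have h2 : ¬ Interlaced s t := by
      rintro ⟨n', h, h', -⟩
      exact hs (by omega)
    rw [Matrix.map_apply, transferMatrix, Matrix.of_apply, if_neg h1, if_neg h2]
    simp
  · simp

/-- The weighted sum over the rows interlaced with `x` of the plane wave of `σ`; the arrow `k`
moves in the gap number `k + o`. -/
def rowSum (c : ℝ) {N n : ℕ} (x : Fin n → Fin N) (z : Fin n → ℂ) (o : ℕ)
    (σ : Equiv.Perm (Fin n)) : ℂ :=
  ∑ y : Fin n → Fin N with StrictMono y, ∏ k : Fin n,
    gapWeight c (gridPoint x (k + o)) (gridPoint x (k + o + 1)) (y k + 1) *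
      z (σ k) ^ (y k + 1 : ℕ)

theorem mulVec_betheVector (c : ℝ) {N n : ℕ} (p : Fin n → ℝ) {s : Finset (Fin N)}
    (hs : s.card = n) :
    ((transferMatrix N c).map Complex.ofReal).mulVec (betheVector c N p) s =
      ∑ σ, amplitude c p σ * (rowSum c (s.orderEmbOfFin hs) (fugacity p) 1 σ +
        rowSum c (s.orderEmbOfFin hs) (fugacity p) 0 σ) := by
  classical
  set x := s.orderEmbOfFin hs with hx
  set G : (Fin n → Fin N) → ℂ := fun y =>
    ((∏ k : Fin n, gapWeight c (gridPoint x (k + 1)) (gridPoint x (k + 2)) (y k + 1)) +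
      ∏ k : Fin n, gapWeight c (gridPoint x k) (gridPoint x (k + 1)) (y k + 1)) *
    betheCoeff c p (fun k => (y k : ℕ) + 1) with hG
  have h1 : ((transferMatrix N c).map Complex.ofReal).mulVec (betheVector c N p) s =
      ∑ t : Finset (Fin N), if h : t.card = n then G (t.orderEmbOfFin h) else 0 := by
    rw [Matrix.mulVec, dotProduct]
    refine sum_congr rfl fun t _ => ?_
    rw [betheVector]
    split_ifs with ht
    · simp only [hG]
      rw [prod_gapWeight_right c x.strictMono, prod_gapWeight_left c x.strictMono,
        Matrix.map_apply, transferMatrix_apply c hs ht, ← pow_diffCount c hs ht]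
      rw [Complex.ofReal_add, apply_ite Complex.ofReal, apply_ite Complex.ofReal,
        Complex.ofReal_zero]
      rfl
    · simp
  rw [h1, sum_card_eq_sum_strictMono]
  simp only [hG, betheCoeff_eq, mul_sum, rowSum, prod_mul_distrib, ← sum_add_distrib, mul_add]
  rw [sum_comm]
  refine sum_congr rfl fun σ _ => sum_congr rfl fun y _ => ?_
  simp only [add_zero]
  ring

theorem rowSum_eq_continuant (c : ℝ) {N n : ℕ} (hN : 0 < N) {x : Fin n → Fin N}
    (hx : StrictMono x) (z : Fin n → ℂ) {o : ℕ} (ho : o ≤ 1) (σ : Equiv.Perm (Fin n)) :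
    rowSum c x z o σ = continuant
      (atPos (fun k j => ∑ v : Fin N,
        gapWeight c (gridPoint x (k + o)) (gridPoint x (k + o + 1)) (v + 1) *
          z j ^ (v + 1 : ℕ)) σ)
      (pairAt (fun k j => z j ^ gridPoint x (k + o + 1)) σ) n := by
  set w : ℕ → Fin N → ℂ := fun k v => atPos (fun k j =>
    gapWeight c (gridPoint x (k + o)) (gridPoint x (k + o + 1)) (v + 1) * z j ^ (v + 1 : ℕ)) σ k
    with hw
  -- The site shared by the gaps of the arrows `k` and `k + 1`; the default value is never
  -- consulted, since only `k + 1 < n` matters.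
  set q : ℕ → Fin N := fun k => if h : k + o < n then x ⟨k + o, h⟩ else ⟨0, hN⟩ with hq
  have hqX : ∀ k, k + 1 < n → (q k : ℕ) + 1 = gridPoint x (k + o + 1) := by
    intro k hk
    have : k + o < n := by omega
    simp only [hq, gridPoint, this, dif_pos]
  have hX := gridPoint_strictMono hx
  have hgap : ∀ k v, k < n → w k v ≠ 0 →
      gridPoint x (k + o) ≤ v + 1 ∧ (v + 1 : ℕ) ≤ gridPoint x (k + o + 1) := by
    intro k v hk hv
    simp only [hw, atPos_of_lt _ σ hk] at hv
    have := left_ne_zero_of_mul hv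
    by_contra h
    exact this (if_neg h)
  have hmain := sum_strictMono_eq_continuant w q n
    (fun m hm v hv => by
      have h1 := (hgap m v (by omega) hv).2
      have h2 := hqX m hm
      rw [Fin.le_def]
      omega)
    (fun m hm v hv => by
      have h1 := (hgap (m + 1) v (by omega) hv).1
      have h2 := hqX m hm
      rw [show m + 1 + o = m + o + 1 by omega] at h1
      rw [Fin.le_def]
      omega)
    (fun m hm => by
      have h1 := hqX m (by omega)
      have h2 := hqX (m + 1) (by omega)
      have h3 : gridPoint x (m + o + 1) < gridPoint x (m + 1 + o + 1) := hX (by omega)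
      rw [Fin.lt_def]
      omega)
  have hl : rowSum c x z o σ = ∑ y : Fin n → Fin N with StrictMono y, ∏ k : Fin n, w k (y k) :=
    sum_congr rfl fun y _ => prod_congr rfl fun k _ => by
      simp only [hw, atPos_of_lt _ σ k.2]
  rw [hl, hmain]
  refine continuant_congr n (fun k hk => ?_) fun k hk => ?_
  · simp only [hw, atPos_of_lt _ σ hk]
  · have h0 : k < n := by omega
    have hlt := hX (show k + o < k + o + 1 by omega)
    have hlt' := hX (show k + o + 1 < k + o + 1 + 1 by omega)
    simp only [hw, pairAt, atPos_of_lt _ σ hk, atPos_of_lt _ σ h0, hqX k hk,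
      show k + 1 + o = k + o + 1 by omega, Nat.add_sub_cancel]
    simp [gapWeight, hlt.le, hlt'.le]

/-- `L(z_j) z_j^{x_k}` in the gap to the right of `x_k` and its modification at the boundary. -/
def leftTerm (c : ℝ) {N n : ℕ} (x : Fin n → Fin N) (z : Fin n → ℂ) (o k : ℕ) (j : Fin n) : ℂ :=
  (L c (z j) - if k + o = 0 then 1 else 0) * z j ^ gridPoint x (k + o)

/-- `M(z_j) z_j^{x_k}` in the gap to the left of `x_k` and its modification at the boundary. -/
def rightTerm (c : ℝ) {N n : ℕ} (x : Fin n → Fin N) (z : Fin n → ℂ) (o k : ℕ) (j : Fin n) : ℂ :=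
  (M c (z j) - if k + o = n then 1 else 0) * z j ^ gridPoint x (k + o + 1)

/-- The heart of the ansatz: `M(z_a) L(z_b) - 1` is `s(b, a)` times a factor symmetric in `a` and
`b`, while the transposition replaces `s(a, b)` by `-s(b, a)` in the amplitude. -/
theorem amplitude_swap_cancel (c : ℝ) {n : ℕ} (p : Fin n → ℝ) (hz : ∀ j, fugacity p j ≠ 1)
    (σ : Equiv.Perm (Fin n)) (i j : Fin n) (hij : (i : ℕ) + 1 = j) :
    amplitude c p σ * (M c (fugacity p (σ i)) * L c (fugacity p (σ j)) - 1) +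
      amplitude c p (σ * Equiv.swap i j) *
        (M c (fugacity p (σ j)) * L c (fugacity p (σ i)) - 1) = 0 := by
  have hML : ∀ a b, M c (fugacity p a) * L c (fugacity p b) - 1 =
      -(c : ℂ) ^ 2 * pairFactor c p b a / ((1 - fugacity p a) * (1 - fugacity p b)) := by
    intro a b
    have ha : 1 - fugacity p a ≠ 0 := sub_ne_zero.2 (hz a).symm
    have hb : 1 - fugacity p b ≠ 0 := sub_ne_zero.2 (hz b).symm
    rw [pairFactor_eq, L, M]
    field_simp
    ring
  have h := orderedAmp_mul_swap (pairFactor c p) σ i j hij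
  rw [← amplitude_eq_orderedAmp, ← amplitude_eq_orderedAmp] at h
  rw [hML, hML, mul_comm (1 - fugacity p (σ j))]
  linear_combination
    (-(c : ℂ) ^ 2 / ((1 - fugacity p (σ i)) * (1 - fugacity p (σ j)))) * h

theorem terms_swap_cancel (c : ℝ) {N n : ℕ} (x : Fin n → Fin N) (p : Fin n → ℝ)
    (hz : ∀ j, fugacity p j ≠ 1) {o : ℕ} (ho : o ≤ 1)
    (σ : Equiv.Perm (Fin n)) (i j : Fin n) (hij : (i : ℕ) + 1 = j) :
    amplitude c p σ * (rightTerm c x (fugacity p) o i (σ i) * leftTerm c x (fugacity p) o j (σ j) -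
        fugacity p (σ i) ^ gridPoint x (i + o + 1) * fugacity p (σ j) ^ gridPoint x (i + o + 1)) +
      amplitude c p (σ * Equiv.swap i j) *
        (rightTerm c x (fugacity p) o i (σ j) * leftTerm c x (fugacity p) o j (σ i) -
        fugacity p (σ i) ^ gridPoint x (i + o + 1) * fugacity p (σ j) ^ gridPoint x (i + o + 1)) =
      0 := by
  have h1 : ¬ (i : ℕ) + o = n := by omega
  have h2 : ¬ (j : ℕ) + o = 0 := by omega
  have h3 : (j : ℕ) + o = i + o + 1 := by omega
  simp only [rightTerm, leftTerm, if_neg h1, if_neg h2]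
  rw [h3]
  linear_combination (fugacity p (σ i) ^ gridPoint x (i + o + 1) *
    fugacity p (σ j) ^ gridPoint x (i + o + 1)) * amplitude_swap_cancel c p hz σ i j hij

theorem sum_rowSum (c : ℝ) {N n : ℕ} (hN : 0 < N) {x : Fin n → Fin N} (hx : StrictMono x)
    (p : Fin n → ℝ) (hz : ∀ j, fugacity p j ≠ 1) {o : ℕ} (ho : o ≤ 1) :
    ∑ σ, amplitude c p σ * rowSum c x (fugacity p) o σ =
      ∑ σ, amplitude c p σ * pathSum (atPos (leftTerm c x (fugacity p) o) σ)
        (atPos (rightTerm c x (fugacity p) o) σ) n := by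
  have h := sum_continuant_eq_sum_pathSum (amplitude c p) (leftTerm c x (fugacity p) o)
    (rightTerm c x (fugacity p) o) (fun k j => fugacity p j ^ gridPoint x (k + o + 1))
    (terms_swap_cancel c x p hz ho) n le_rfl (fun _ => 1) (fun _ _ _ => rfl)
  simp only [mul_one] at h
  rw [← h]
  refine sum_congr rfl fun σ _ => ?_
  rw [rowSum_eq_continuant c hN hx _ ho]
  congr 1
  refine continuant_congr n (fun k hk => ?_) fun _ _ => rfl
  simp only [atPos_of_lt _ σ hk, leftTerm, rightTerm]
  exact sum_gapWeight c hx (hz _) (by omega)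

/-! ### Boundary gaps and the eigenvalue identity with remainder -/

/-- `(-1)^{n-1} ∏_{k ≠ j} s(j, k) / s(k, j)`, the right-hand side of Bethe's equations. -/
def scattering (c : ℝ) {n : ℕ} (p : Fin n → ℝ) (j : Fin n) : ℂ :=
  (-1) ^ (n - 1) * ∏ k with k ≠ j, (pairFactor c p j k / pairFactor c p k j)

theorem amplitude_eq_scattering_mul (c : ℝ) {m : ℕ} (p : Fin (m + 1) → ℝ)
    (hs : ∀ j k, pairFactor c p j k ≠ 0) (σ : Equiv.Perm (Fin (m + 1))) :
    amplitude c p σ = scattering c p (σ 0) * amplitude c p (σ * finRotate (m + 1)) := by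
  have h := orderedAmp_mul_finRotate (pairFactor c p) σ
  rw [← amplitude_eq_orderedAmp, ← amplitude_eq_orderedAmp] at h
  have hne : ∏ j with j ≠ σ 0, pairFactor c p j (σ 0) ≠ 0 := prod_ne_zero_iff.2 fun j _ => hs _ _
  rw [scattering, prod_div_distrib, Nat.add_sub_cancel, mul_div_assoc', div_mul_eq_mul_div,
    eq_div_iff hne, h]

/-- The path sum through the gaps between consecutive arrows. -/
def innerSum (c : ℝ) {N m : ℕ} (x : Fin (m + 1) → Fin N) (p : Fin (m + 1) → ℝ)
    (σ : Equiv.Perm (Fin (m + 1))) : ℂ :=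
  pathSum (atPos (leftTerm c x (fugacity p) 1) σ) (atPos (rightTerm c x (fugacity p) 1) σ) m

theorem prod_prod_pow_perm {n : ℕ} (g z : Fin n → ℂ) (x : Fin n → ℕ) (σ : Equiv.Perm (Fin n)) :
    ∏ k : Fin n, g (σ k) * z (σ k) ^ x k = (∏ j, g j) * ∏ k, z (σ k) ^ x k := by
  rw [prod_mul_distrib, Equiv.prod_comp σ g]

/-- Bethe's equations are not assumed, so the identity can also be used at perturbed momenta; they
serve only to make the last sum vanish. -/
theorem mulVec_betheVector_eq (c : ℝ) {N m : ℕ} (hN : 0 < N) (p : Fin (m + 1) → ℝ)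
    (hz : ∀ j, fugacity p j ≠ 1) (hs : ∀ j k, pairFactor c p j k ≠ 0)
    {s : Finset (Fin N)} (hcard : s.card = m + 1) :
    ((transferMatrix N c).map Complex.ofReal).mulVec (betheVector c N p) s =
      ((∏ j, L c (fugacity p j)) + ∏ j, M c (fugacity p j)) * betheVector c N p s +
      ∑ σ, amplitude c p σ * innerSum c (s.orderEmbOfFin hcard) p σ *
        ((scattering c p (σ (Fin.last m)) - fugacity p (σ (Fin.last m)) ^ N) *
          (L c (fugacity p (σ (Fin.last m))) - 1)) := by
  set x := s.orderEmbOfFin hcard with hxdef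
  have hx : StrictMono x := x.strictMono
  set z := fugacity p with hzdef
  have hψ : betheVector c N p s = ∑ σ, amplitude c p σ * ∏ k, z (σ k) ^ ((x k : ℕ) + 1) := by
    rw [betheVector, dif_pos hcard, betheCoeff_eq]
    rfl
  have h1 : ∀ σ, pathSum (atPos (leftTerm c x z 1) σ) (atPos (rightTerm c x z 1) σ) (m + 1) =
      (∏ j, L c (z j)) * (∏ k, z (σ k) ^ ((x k : ℕ) + 1)) -
        innerSum c x p σ * (z (σ (Fin.last m)) ^ N * (L c (z (σ (Fin.last m))) - 1)) := by
    intro σ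
    rw [pathSum, prod_range_atPos, ← prod_prod_pow_perm, innerSum, ← hzdef,
      atPos_of_lt _ σ (Nat.lt_succ_self m)]
    -- Rests on `(M(z) - 1) z = -(L(z) - 1)`, which makes the two boundary gaps comparable.
    have hr : rightTerm c x z 1 m (σ (Fin.last m)) =
        -(z (σ (Fin.last m)) ^ N * (L c (z (σ (Fin.last m))) - 1)) := by
      have hg := gridPoint_last x
      have hne : 1 - z (σ (Fin.last m)) ≠ 0 := sub_ne_zero.2 (hz _).symm
      rw [rightTerm, if_pos rfl, hg, L, M, pow_succ]
      field_simp
      ring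
    have hl : ∀ k : Fin (m + 1), leftTerm c x z 1 k (σ k) =
        L c (z (σ k)) * z (σ k) ^ ((x k : ℕ) + 1) := by
      intro k
      rw [leftTerm, if_neg (by omega), gridPoint_succ, sub_zero]
    rw [prod_congr rfl fun k _ => hl k]
    rw [show (⟨m, Nat.lt_succ_self m⟩ : Fin (m + 1)) = Fin.last m from rfl, hr]
    ring
  have h0 : ∀ σ, pathSum (atPos (leftTerm c x z 0) σ) (atPos (rightTerm c x z 0) σ) (m + 1) =
      (∏ j, M c (z j)) * (∏ k, z (σ k) ^ ((x k : ℕ) + 1)) +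
        (L c (z (σ 0)) - 1) * innerSum c x p (σ * finRotate (m + 1)) := by
    intro σ
    rw [pathSum_succ', prod_range_atPos, ← prod_prod_pow_perm, innerSum, ← hzdef]
    congr 1
    · refine prod_congr rfl fun k _ => ?_
      rw [rightTerm, if_neg (by omega), add_zero, gridPoint_succ, sub_zero]
    · congr 1
      · rw [atPos_of_lt _ σ (Nat.succ_pos m), leftTerm]
        simp [gridPoint]
      · have hrot : ∀ k (hk : k < m), finRotate (m + 1) ⟨k, by omega⟩ = ⟨k + 1, by omega⟩ := by
          intro k hk
          exact finRotate_of_lt hk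
        refine pathSum_congr (fun k hk => ?_) fun k hk => ?_
        · rw [atPos_of_lt _ _ (show k + 1 < m + 1 by omega),
            atPos_of_lt _ _ (show k < m + 1 by omega), Equiv.Perm.mul_apply, hrot k hk,
            leftTerm, leftTerm]
        · rw [atPos_of_lt _ _ (show k + 1 < m + 1 by omega),
            atPos_of_lt _ _ (show k < m + 1 by omega), Equiv.Perm.mul_apply, hrot k hk,
            rightTerm, rightTerm, if_neg (by omega)]
  -- Rotating the particle of the gap before `x_1` into the last place costs its scattering factor
  -- and gives both families the same inner sum.
  have hrotsum : ∑ σ, amplitude c p σ *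
      ((L c (z (σ 0)) - 1) * innerSum c x p (σ * finRotate (m + 1))) =
      ∑ σ, scattering c p (σ (Fin.last m)) * amplitude c p σ *
        ((L c (z (σ (Fin.last m))) - 1) * innerSum c x p σ) := by
    rw [← Equiv.sum_comp (Equiv.mulRight (finRotate (m + 1))) (fun σ : Equiv.Perm (Fin (m + 1)) =>
      scattering c p (σ (Fin.last m)) * amplitude c p σ *
        ((L c (z (σ (Fin.last m))) - 1) * innerSum c x p σ))]
    refine sum_congr rfl fun σ _ => ?_
    simp only [Equiv.coe_mulRight, Equiv.Perm.mul_apply, finRotate_last]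
    rw [← amplitude_eq_scattering_mul c p hs]
  rw [mulVec_betheVector c p hcard]
  simp only [mul_add, sum_add_distrib]
  rw [sum_rowSum c hN hx p hz le_rfl, sum_rowSum c hN hx p hz zero_le_one]
  simp only [← hzdef, h0, h1, mul_add, mul_sub, sum_add_distrib, sum_sub_distrib]
  rw [hrotsum, hψ, add_mul, mul_sum, mul_sum, ← sub_eq_zero]
  simp only [← sum_add_distrib, ← sum_sub_distrib]
  refine sum_eq_zero fun σ _ => ?_
  ring

/-! ### The phase `Θ` and Bethe's equations -/

theorem S_ne_zero {Δ x y : ℝ} (hΔ : Δ < 1) (hx : x ∈ D Δ) (hy : y ∈ D Δ) : S Δ x y ≠ 0 := by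
  intro h
  have h1 := two_mul_halfPhase Δ x y
  rw [h, mul_zero] at h1
  exact Complex.slitPlane_ne_zero (halfPhase_mem hΔ hx hy) (by simpa using h1)

theorem pairFactor_ne_zero {c : ℝ} {n : ℕ} {p : Fin n → ℝ} (hΔ : anisotropy c < 1)
    (hp : ∀ j, p j ∈ D (anisotropy c)) (a b : Fin n) : pairFactor c p a b ≠ 0 :=
  mul_ne_zero (Complex.exp_ne_zero _) (S_ne_zero hΔ (hp a) (hp b))

theorem anisotropy_lt_one {c : ℝ} (hc : 0 < c) : anisotropy c < 1 := by
  have : 0 < c ^ 2 := by positivity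
  rw [anisotropy]
  linarith

theorem exp_I_mul_ne_one {Δ x : ℝ} (hx : x ∈ D Δ) (h0 : x ≠ 0) :
    Complex.exp (Complex.I * x) ≠ 1 := by
  intro h
  obtain ⟨k, hk⟩ := Complex.exp_eq_one_iff.1 h
  have h1 : (x : ℂ) = k * (2 * Real.pi) := by
    apply mul_left_cancel₀ Complex.I_ne_zero
    linear_combination hk
  have h2 : x = k * (2 * Real.pi) := by exact_mod_cast h1
  have h3 := abs_lt_of_mem_D hx
  have h4 := mu_nonneg Δ
  have hk0 : k ≠ 0 := by
    rintro rfl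
    exact h0 (by simpa using h2)
  have h5 : (1 : ℝ) ≤ |(k : ℝ)| := by exact_mod_cast Int.one_le_abs hk0
  rw [h2, abs_mul, abs_of_pos (by positivity : (0 : ℝ) < 2 * Real.pi)] at h3
  nlinarith [Real.pi_pos]

theorem exp_theta {c : ℝ} {n : ℕ} {p : Fin n → ℝ} (hΔ : anisotropy c < 1)
    (hp : ∀ j, p j ∈ D (anisotropy c)) (a b : Fin n) :
    Complex.exp (-(Complex.I * (theta (anisotropy c) (p a) (p b) : ℂ))) =
      pairFactor c p a b / pairFactor c p b a := by
  rw [(isTheta_theta hΔ).exp_eq _ (hp a) _ (hp b), pairFactor, pairFactor, mul_sub,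
    Complex.exp_sub]
  ring

theorem scattering_eq_exp {c : ℝ} {n : ℕ} {p : Fin n → ℝ} (hΔ : anisotropy c < 1)
    (hp : ∀ j, p j ∈ D (anisotropy c)) (j : Fin n) :
    scattering c p j = (-1) ^ (n - 1) * Complex.exp (-(Complex.I *
      ∑ k with k ≠ j, (theta (anisotropy c) (p j) (p k) : ℂ))) := by
  rw [scattering, mul_sum, ← sum_neg_distrib, Complex.exp_sum]
  congr 1
  exact prod_congr rfl fun k _ => (exp_theta hΔ hp j k).symm

theorem BetheEquations.fugacity_pow {c : ℝ} {N n : ℕ} {p : Fin n → ℝ} (hΔ : anisotropy c < 1)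
    (hp : ∀ j, p j ∈ D (anisotropy c)) (h : BetheEquations c N p) (j : Fin n) :
    scattering c p j = fugacity p j ^ N := by
  have h1 := h j
  have h2 : fugacity p j ^ N = Complex.exp (Complex.I * N * p j) := by
    rw [fugacity, ← Complex.exp_nat_mul]
    congr 1
    ring
  rw [h2, h1, scattering, mul_sum, ← sum_neg_distrib, Complex.exp_sum, prod_filter]
  congr 1
  refine prod_congr rfl fun k _ => ?_
  rw [exp_theta hΔ hp]
  split_ifs with hk
  · rfl
  · rw [not_not.1 hk, div_self (pairFactor_ne_zero hΔ hp j j)]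

/-- Uniqueness identifies `theta` near `0` with the explicit phase `-2 Im log (halfPhase)`, whose
argument stays in the slit plane. -/
theorem differentiableAt_theta {Δ y : ℝ} (hΔ : Δ < 1) (hy : y ∈ D Δ) :
    DifferentiableAt ℝ (fun t => theta Δ t y) 0 := by
  have h0 := zero_mem_D hΔ
  have hev : (fun t => -2 * (Complex.log (halfPhase Δ t y)).im) =ᶠ[nhds 0]
      fun t => theta Δ t y := by
    filter_upwards [isOpen_Ioo.mem_nhds h0] with t ht
    rw [Complex.log_im]
    exact theta_unique hΔ (isTheta_arg hΔ) ht hy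
  refine DifferentiableAt.congr_of_eventuallyEq ?_ hev.symm
  have h1 : DifferentiableAt ℝ (fun t : ℝ => halfPhase Δ t y) 0 := by
    have hcos : DifferentiableAt ℝ (fun t : ℝ => ((Real.cos ((t + y) / 2) : ℝ) : ℂ)) 0 :=
      have h : DifferentiableAt ℝ (fun t : ℝ => Real.cos ((t + y) / 2)) 0 := by fun_prop
      Complex.ofRealCLM.differentiableAt.comp (0 : ℝ) h
    have hlin : DifferentiableAt ℝ (fun t : ℝ => (((t - y) / 2 : ℝ) : ℂ)) 0 :=
      have h : DifferentiableAt ℝ (fun t : ℝ => (t - y) / 2) 0 := by fun_prop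
      Complex.ofRealCLM.differentiableAt.comp (0 : ℝ) h
    unfold halfPhase
    exact hcos.sub ((differentiableAt_const _).mul ((differentiableAt_const _).mul hlin).cexp)
  have h2 : DifferentiableAt ℝ (fun t : ℝ => Complex.log (halfPhase Δ t y)) 0 := by
    have h3 : DifferentiableAt ℂ Complex.log (halfPhase Δ 0 y) :=
      Complex.differentiableAt_log (halfPhase_mem hΔ h0 hy)
    exact (h3.restrictScalars ℝ).comp (0 : ℝ) h1
  exact (differentiableAt_const _).mul (Complex.imCLM.differentiableAt.comp (0 : ℝ) h2)

/-! ### Non-zero momenta -/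

theorem mulVec_betheVector_of_ne_zero {c : ℝ} (hc : 0 < c) {N n : ℕ} (hN : 0 < N)
    {p : Fin n → ℝ} (hp : ∀ j, p j ∈ D (anisotropy c)) (hBE : BetheEquations c N p)
    (h0 : ∀ j, p j ≠ 0) :
    ((transferMatrix N c).map Complex.ofReal).mulVec (betheVector c N p) =
      ((∏ j, L c (fugacity p j)) + ∏ j, M c (fugacity p j)) • betheVector c N p := by
  have hΔ := anisotropy_lt_one hc
  funext s
  rw [Pi.smul_apply, smul_eq_mul]
  by_cases hs : s.card = n
  · rcases n with _ | m
    -- Without arrows both row sums are 1 and both products are empty, so the eigenvalue is 2.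
    · rw [mulVec_betheVector c p hs, betheVector, dif_pos hs, betheCoeff_eq, mul_sum]
      refine sum_congr rfl fun σ _ => ?_
      rw [rowSum_eq_continuant c hN (s.orderEmbOfFin hs).strictMono _ le_rfl,
        rowSum_eq_continuant c hN (s.orderEmbOfFin hs).strictMono _ zero_le_one]
      simp only [continuant, univ_eq_empty, prod_empty]
      ring
    · rw [mulVec_betheVector_eq c hN p (fun j => exp_I_mul_ne_one (hp j) (h0 j))
        (pairFactor_ne_zero hΔ hp) hs, add_eq_left]
      refine sum_eq_zero fun σ _ => ?_
      rw [hBE.fugacity_pow hΔ hp]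
      ring
  · rw [mulVec_betheVector_of_card_ne c p hs, betheVector, dif_neg hs, mul_zero]

/-! ### A vanishing momentum -/

/-- A distinguished particle in the last position can be moved to all the others. -/
theorem sum_pathSum_slide {n : ℕ} (A : Equiv.Perm (Fin n) → ℂ) (l r : ℕ → Fin n → ℂ)
    (a : Fin n)
    (hA : ∀ (σ : Equiv.Perm (Fin n)) (i j : Fin n), (i : ℕ) + 1 = j → σ i = a →
      A (σ * Equiv.swap i j) * r i (σ j) = A σ * l j (σ j))
    (hl : ∀ k, l k a = 1) (m : ℕ) (hm : m < n) (h : Equiv.Perm (Fin n) → ℂ)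
    (hh : DependsFrom (m + 1) h) :
    ∑ σ, A σ * pathSum (atPos l σ) (atPos r σ) m * (if σ ⟨m, hm⟩ = a then h σ else 0) =
      ∑ σ, A σ * (∏ k ∈ range (m + 1), atPos l σ k) *
        (if (σ.symm a : ℕ) ≤ m then h σ else 0) := by
  have hpos : ∀ (σ : Equiv.Perm (Fin n)) (k : ℕ) (hk : k < n),
      σ ⟨k, hk⟩ = a ↔ (σ.symm a : ℕ) = k := by
    intro σ k hk
    rw [← Equiv.eq_symm_apply, Fin.ext_iff]
    exact eq_comm
  induction m generalizing h with
  | zero =>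
    refine sum_congr rfl fun σ _ => ?_
    simp only [hpos, Nat.le_zero, zero_add, prod_range_one, pathSum]
    split_ifs with h0
    · rw [atPos_of_lt l σ hm, (hpos σ 0 hm).2 h0, hl]
    · simp
  | succ m ih =>
    have hm' : m < n := by omega
    set i : Fin n := ⟨m, hm'⟩ with hi
    set j : Fin n := ⟨m + 1, hm⟩ with hj
    -- Words ending in `r`: exchanging the last two places moves `a` one step left and turns `r_m`
    -- into `l_{m+1}`, after which induction applies.
    have h1 : ∑ σ, A σ * (pathSum (atPos l σ) (atPos r σ) m * atPos r σ m) *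
        (if σ j = a then h σ else 0) =
        ∑ σ, A σ * (∏ k ∈ range (m + 2), atPos l σ k) *
          (if (σ.symm a : ℕ) ≤ m then h σ else 0) := by
      have e := ih hm' (fun σ => atPos l σ (m + 1) * h σ)
        ((dependsFrom_atPos l le_rfl).mul (hh.mono (by omega)))
      rw [← Equiv.sum_comp (Equiv.mulRight (Equiv.swap i j))]
      have e' : ∑ σ, A σ * (∏ k ∈ range (m + 2), atPos l σ k) *
          (if (σ.symm a : ℕ) ≤ m then h σ else 0) =
          ∑ σ, A σ * (∏ k ∈ range (m + 1), atPos l σ k) *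
          (if (σ.symm a : ℕ) ≤ m then atPos l σ (m + 1) * h σ else 0) := by
        refine sum_congr rfl fun σ _ => ?_
        rw [prod_range_succ]
        split_ifs <;> ring
      rw [e', ← e]
      refine sum_congr rfl fun σ _ => ?_
      have hhs : h (σ * Equiv.swap i j) = h σ := hh _ _ fun k hk => by
        rw [Equiv.Perm.mul_apply, Equiv.swap_apply_of_ne_of_ne] <;> rintro rfl <;>
          simp [hi, hj] at hk
      have hsi : (σ * Equiv.swap i j) i = σ j := by
        rw [Equiv.Perm.mul_apply, Equiv.swap_apply_left]
      have hsj : (σ * Equiv.swap i j) j = σ i := by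
        rw [Equiv.Perm.mul_apply, Equiv.swap_apply_right]
      have hps := pathSum_atPos_mul_swap l r σ (i := i) (j := j) (m := m) (by simp [hi])
        (by simp [hj])
      have hr : atPos r (σ * Equiv.swap i j) m = r m (σ j) := by
        rw [atPos_of_lt r _ hm', ← hi, hsi]
      change A (σ * Equiv.swap i j) * (pathSum (atPos l (σ * Equiv.swap i j))
        (atPos r (σ * Equiv.swap i j)) m * atPos r (σ * Equiv.swap i j) m) *
        (if (σ * Equiv.swap i j) j = a then h (σ * Equiv.swap i j) else 0) = _ *
        (if σ i = a then _ else 0)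
      rw [hhs, hps, hr, atPos_of_lt l _ hm]
      by_cases ha : σ i = a
      · rw [if_pos (hsj.trans ha), if_pos ha]
        linear_combination (pathSum (atPos l σ) (atPos r σ) m * h σ) * hA σ i j rfl ha
      · rw [if_neg (fun h' => ha (hsj.symm.trans h')), if_neg ha, mul_zero, mul_zero]
    -- The pure `l` word leaves `a` where it is; its own factor is 1. Thus every place of `a` arises
    -- exactly once.
    have h2 : ∑ σ, A σ * (∏ k ∈ range (m + 1), atPos l σ k) * (if σ j = a then h σ else 0) =
        ∑ σ, A σ * (∏ k ∈ range (m + 2), atPos l σ k) *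
          (if (σ.symm a : ℕ) = m + 1 then h σ else 0) := by
      refine sum_congr rfl fun σ _ => ?_
      simp only [hj, hpos]
      split_ifs with h0
      · rw [prod_range_succ _ (m + 1), atPos_of_lt l σ hm, (hpos σ _ hm).2 h0, hl, mul_one]
      · simp
    calc _ = ∑ σ, A σ * (pathSum (atPos l σ) (atPos r σ) m * atPos r σ m) *
            (if σ j = a then h σ else 0) +
          ∑ σ, A σ * (∏ k ∈ range (m + 1), atPos l σ k) * (if σ j = a then h σ else 0) := by
          rw [← sum_add_distrib]
          refine sum_congr rfl fun σ _ => ?_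
          rw [pathSum]
          ring
      _ = _ := by
          rw [h1, h2, ← sum_add_distrib]
          refine sum_congr rfl fun σ _ => ?_
          rw [← mul_add]
          congr 1
          by_cases h3 : (σ.symm a : ℕ) ≤ m
          · rw [if_pos h3, if_neg (by omega), if_pos (by omega), add_zero]
          · by_cases h4 : (σ.symm a : ℕ) = m + 1
            · rw [if_neg h3, if_pos h4, if_pos (by omega), zero_add]
            · rw [if_neg h3, if_neg h4, if_neg (by omega), add_zero]

theorem pairFactor_zero_left (c : ℝ) {n : ℕ} {p : Fin n → ℝ} {a b : Fin n} (ha : p a = 0)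
    (hb : fugacity p b ≠ 1) :
    pairFactor c p a b = -((1 - fugacity p b) * M c (fugacity p b)) := by
  have h1 : fugacity p a = 1 := by simp [fugacity, ha]
  have h2 : 1 - fugacity p b ≠ 0 := sub_ne_zero.2 hb.symm
  rw [pairFactor_eq, h1, M]
  field_simp
  ring

theorem pairFactor_zero_right (c : ℝ) {n : ℕ} {p : Fin n → ℝ} {a b : Fin n} (ha : p a = 0)
    (hb : fugacity p b ≠ 1) :
    pairFactor c p b a = (1 - fugacity p b) * L c (fugacity p b) := by
  have h1 : fugacity p a = 1 := by simp [fugacity, ha]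
  have h2 : 1 - fugacity p b ≠ 0 := sub_ne_zero.2 hb.symm
  rw [pairFactor_eq, h1, L]
  field_simp
  ring

/-- For `z_a = 1` the exchange relation reduces to `A_{σ·swap} M(z_j) = A_σ L(z_j)`, where `a`
passes `j`. So `a` slides left through the `r` letters, converting each into an `l`, and the sum
over its places rebuilds `ψ`. -/
theorem sum_innerSum_of_zero (c : ℝ) {N m : ℕ} (p : Fin (m + 1) → ℝ) {a : Fin (m + 1)}
    (ha : p a = 0) (hz : ∀ j, j ≠ a → fugacity p j ≠ 1) {s : Finset (Fin N)}
    (hs : s.card = m + 1) :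
    ∑ σ : Equiv.Perm (Fin (m + 1)), amplitude c p σ * innerSum c (s.orderEmbOfFin hs) p σ *
        (if σ (Fin.last m) = a then 1 else 0) =
      (∏ j with j ≠ a, L c (fugacity p j)) * betheVector c N p s := by
  set x := s.orderEmbOfFin hs
  have hza : fugacity p a = 1 := by simp [fugacity, ha]
  set l : ℕ → Fin (m + 1) → ℂ := fun k j =>
    (if j ≠ a then L c (fugacity p j) else 1) * fugacity p j ^ gridPoint x (k + 1) with hl
  have h := sum_pathSum_slide (amplitude c p) l (rightTerm c x (fugacity p) 1) a
    (fun σ i j hij hi => by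
      have hne : σ j ≠ a := by
        rw [← hi]
        exact fun h' => by
          have := σ.injective h'
          rw [this] at hij
          omega
      have hsw := orderedAmp_mul_swap (pairFactor c p) σ i j hij
      rw [← amplitude_eq_orderedAmp, ← amplitude_eq_orderedAmp, hi,
        pairFactor_zero_left c ha (hz _ hne), pairFactor_zero_right c ha (hz _ hne)] at hsw
      have h2 : 1 - fugacity p (σ j) ≠ 0 := sub_ne_zero.2 (hz _ hne).symm
      have h3 : amplitude c p (σ * Equiv.swap i j) * M c (fugacity p (σ j)) =
          amplitude c p σ * L c (fugacity p (σ j)) :=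
        mul_left_cancel₀ h2 (by linear_combination -hsw)
      rw [hl, rightTerm, if_neg (by omega), ← hij]
      simp only [if_pos hne]
      linear_combination (fugacity p (σ j) ^ gridPoint x (i + 1 + 1)) * h3)
    (fun k => by simp [hl, hza]) m (Nat.lt_succ_self m) (fun _ => 1) (fun _ _ _ => rfl)
  have hψ : betheVector c N p s =
      ∑ σ, amplitude c p σ * ∏ k, fugacity p (σ k) ^ ((x k : ℕ) + 1) := by
    rw [betheVector, dif_pos hs, betheCoeff_eq]
    rfl
  have hR : ∀ σ : Equiv.Perm (Fin (m + 1)), ∏ k ∈ range (m + 1), atPos l σ k =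
      (∏ j with j ≠ a, L c (fugacity p j)) * ∏ k, fugacity p (σ k) ^ ((x k : ℕ) + 1) := by
    intro σ
    rw [prod_range_atPos, prod_filter, ← prod_prod_pow_perm]
    refine prod_congr rfl fun k _ => ?_
    simp only [hl, gridPoint_succ]
  have hle : ∀ σ : Equiv.Perm (Fin (m + 1)), (σ.symm a : ℕ) ≤ m := fun σ => by omega
  calc _ = ∑ σ : Equiv.Perm (Fin (m + 1)), amplitude c p σ *
        pathSum (atPos l σ) (atPos (rightTerm c x (fugacity p) 1) σ) m *
        (if σ (Fin.last m) = a then 1 else 0) := by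
        refine sum_congr rfl fun σ _ => ?_
        split_ifs with hσ
        · rw [innerSum]
          congr 2
          refine pathSum_congr (fun k hk => ?_) fun _ _ => rfl
          have hne : σ ⟨k, by omega⟩ ≠ a := by
            rw [← hσ]
            intro h'
            have := congrArg Fin.val (σ.injective h')
            simp at this
            omega
          rw [atPos_of_lt _ σ (by omega), atPos_of_lt _ σ (by omega), leftTerm, hl]
          simp only [if_pos hne]
          rw [if_neg (by omega), sub_zero]
        · simp
    _ = _ := by
        rw [show Fin.last m = ⟨m, Nat.lt_succ_self m⟩ from rfl, h, hψ, mul_sum]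
        refine sum_congr rfl fun σ _ => ?_
        rw [hR, if_pos (hle σ)]
        ring

/-! ### Continuity in the momenta and the limit at a vanishing momentum -/

open Filter Topology

theorem continuous_amplitude (c : ℝ) {n : ℕ} (σ : Equiv.Perm (Fin n)) :
    Continuous fun p : Fin n → ℝ => amplitude c p σ := by
  unfold amplitude S
  fun_prop

theorem continuous_fugacity {n : ℕ} (j : Fin n) : Continuous fun p : Fin n → ℝ => fugacity p j := by
  unfold fugacity
  fun_prop

theorem continuous_pairFactor (c : ℝ) {n : ℕ} (a b : Fin n) :
    Continuous fun p : Fin n → ℝ => pairFactor c p a b := by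
  unfold pairFactor S
  fun_prop

theorem continuous_betheVector (c : ℝ) {N n : ℕ} (s : Finset (Fin N)) :
    Continuous fun p : Fin n → ℝ => betheVector c N p s := by
  unfold betheVector betheCoeff
  split_ifs
  · refine continuous_finsetSum _ fun σ _ => (continuous_amplitude c σ).mul ?_
    fun_prop
  · exact continuous_const

theorem continuous_continuant {X : Type*} [TopologicalSpace X] {W E : X → ℕ → ℂ}
    (hW : ∀ k, Continuous fun t => W t k) (hE : ∀ k, Continuous fun t => E t k) (m : ℕ) :
    Continuous fun t => continuant (W t) (E t) m := by
  induction m using Nat.twoStepInduction with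
  | zero => exact continuous_const
  | one => exact hW 0
  | more m ih1 ih2 => exact ((hW _).mul ih2).sub ((hE _).mul ih1)

theorem continuous_atPos {X : Type*} [TopologicalSpace X] {n : ℕ} {f : X → ℕ → Fin n → ℂ}
    (hf : ∀ k j, Continuous fun t => f t k j) (σ : Equiv.Perm (Fin n)) (k : ℕ) :
    Continuous fun t => atPos (f t) σ k := by
  unfold atPos
  split_ifs
  · exact hf _ _
  · exact continuous_const

/-- The weighted sum over the rows with one arrow in each gap between consecutive arrows of `x`. -/
def innerRowSum (c : ℝ) {N m : ℕ} (x : Fin (m + 1) → Fin N) (p : Fin (m + 1) → ℝ)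
    (σ : Equiv.Perm (Fin (m + 1))) : ℂ :=
  continuant
    (atPos (fun k j => ∑ v : Fin N,
      gapWeight c (gridPoint x (k + 1)) (gridPoint x (k + 1 + 1)) (v + 1) *
        fugacity p j ^ (v + 1 : ℕ)) σ)
    (pairAt (fun k j => fugacity p j ^ gridPoint x (k + 1 + 1)) σ) m

theorem continuous_innerRowSum (c : ℝ) {N m : ℕ} (x : Fin (m + 1) → Fin N)
    (σ : Equiv.Perm (Fin (m + 1))) :
    Continuous fun p : Fin (m + 1) → ℝ => innerRowSum c x p σ := by
  refine continuous_continuant (fun k => continuous_atPos (fun k j => ?_) σ k)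
    (fun k => Continuous.mul (continuous_atPos (fun k j => ?_) σ k)
      (continuous_atPos (fun k j => ?_) σ _)) m
  · exact continuous_finsetSum _ fun v _ => continuous_const.mul ((continuous_fugacity j).pow _)
  · exact (continuous_fugacity j).pow _
  · exact (continuous_fugacity j).pow _

/-- The inner sums involve `L` and `M`, singular at `z = 1`; the row sums are polynomial in the
fugacities, which shows that the antisymmetrised expression stays bounded as a momentum tends to
zero. -/
theorem sum_innerSum_eq_sum_innerRowSum (c : ℝ) {N m : ℕ} {x : Fin (m + 1) → Fin N}
    (hx : StrictMono x) (p : Fin (m + 1) → ℝ) (hz : ∀ j, fugacity p j ≠ 1)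
    (h : Fin (m + 1) → ℂ) :
    ∑ σ, amplitude c p σ * innerSum c x p σ * h (σ (Fin.last m)) =
      ∑ σ, amplitude c p σ * innerRowSum c x p σ * h (σ (Fin.last m)) := by
  unfold innerSum
  rw [← sum_continuant_eq_sum_pathSum (amplitude c p) (leftTerm c x (fugacity p) 1)
    (rightTerm c x (fugacity p) 1) (fun k j => fugacity p j ^ gridPoint x (k + 1 + 1))
    (terms_swap_cancel c x p hz le_rfl) m (Nat.le_succ m) (fun σ => h (σ (Fin.last m)))
    (fun σ τ hst => congrArg h (hst (Fin.last m) le_rfl))]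
  refine sum_congr rfl fun σ _ => ?_
  congr 2
  refine continuant_congr m (fun k hk => ?_) fun _ _ => rfl
  simp only [atPos_of_lt _ σ (show k < m + 1 by omega), leftTerm, rightTerm]
  exact (sum_gapWeight c hx (hz _) (by omega)).symm

/-- `∏_{j ≠ a} L(z_j) = ∏_{j ≠ a} M(z_j)` if `p_a = 0` satisfies its Bethe equation. -/
theorem prod_L_eq_prod_M (c : ℝ) {n : ℕ} (p : Fin n → ℝ) {a : Fin n} (ha : p a = 0)
    (hz : ∀ j, j ≠ a → fugacity p j ≠ 1) (hs : ∀ j k, pairFactor c p j k ≠ 0)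
    (hscat : scattering c p a = 1) :
    ∏ j with j ≠ a, L c (fugacity p j) = ∏ j with j ≠ a, M c (fugacity p j) := by
  have hL : ∀ j, j ≠ a → L c (fugacity p j) ≠ 0 := fun j hj => by
    have := hs j a
    rw [pairFactor_zero_right c ha (hz j hj)] at this
    exact right_ne_zero_of_mul this
  -- Each ratio is `-M/L`, and the resulting `n - 1` signs cancel the prefactor of `scattering`.
  have h1 : ∏ k with k ≠ a, (pairFactor c p a k / pairFactor c p k a) =
      ∏ k with k ≠ a, (-1 * (M c (fugacity p k) / L c (fugacity p k))) := by
    refine prod_congr rfl fun k hk => ?_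
    have hk := (mem_filter.1 hk).2
    have h2 : 1 - fugacity p k ≠ 0 := sub_ne_zero.2 (hz k hk).symm
    have h3 := hL k hk
    rw [pairFactor_zero_left c ha (hz k hk), pairFactor_zero_right c ha (hz k hk)]
    field_simp
  have hcard : (univ.filter fun k : Fin n => k ≠ a).card = n - 1 := by
    rw [filter_ne', card_erase_of_mem (mem_univ a), card_univ, Fintype.card_fin]
  have hne : ∏ j with j ≠ a, L c (fugacity p j) ≠ 0 :=
    prod_ne_zero_iff.2 fun j hj => hL j (mem_filter.1 hj).2
  rw [scattering, h1, prod_mul_distrib, prod_const, hcard, ← mul_assoc, ← mul_pow, neg_one_mul,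
    neg_neg, one_pow, one_mul, prod_div_distrib, div_eq_one_iff_eq hne] at hscat
  exact hscat.symm

theorem tendsto_scattering_sub_pow {c : ℝ} (hc : 0 < c) {N n : ℕ} {p : Fin n → ℝ}
    (hp : ∀ j, p j ∈ D (anisotropy c)) {a : Fin n} (ha : p a = 0)
    (hscat : scattering c p a = 1) :
    Tendsto (fun t : ℝ => (scattering c (Function.update p a t) a -
        fugacity (Function.update p a t) a ^ N) *
        (L c (fugacity (Function.update p a t) a) - 1)) (𝓝[≠] 0)
      (𝓝 ((c : ℂ) ^ 2 * (N + ∑ j with j ≠ a,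
        ((deriv (fun t => theta (anisotropy c) t (p j)) 0 : ℝ) : ℂ)))) := by
  have hΔ := anisotropy_lt_one hc
  set d : Fin n → ℝ := fun j => deriv (fun t => theta (anisotropy c) t (p j)) 0
  set g : ℝ → ℂ := fun t => (-1) ^ (n - 1) * Complex.exp (-(Complex.I *
      ∑ k with k ≠ a, (theta (anisotropy c) t (p k) : ℂ))) with hg
  have hup : ∀ t ∈ D (anisotropy c), ∀ j, Function.update p a t j ∈ D (anisotropy c) := by
    intro t ht j
    by_cases hj : j = a
    · subst hj
      simpa using ht
    · simpa [hj] using hp j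
  have hsg : ∀ t ∈ D (anisotropy c), scattering c (Function.update p a t) a = g t := by
    intro t ht
    rw [scattering_eq_exp hΔ (hup t ht), hg]
    congr 4
    refine sum_congr rfl fun k hk => ?_
    rw [Function.update_self, Function.update_of_ne (mem_filter.1 hk).2]
  have hg0 : g 0 = 1 := by
    rw [← hsg 0 (zero_mem_D hΔ), ← hscat, ← ha, Function.update_eq_self]
  have hgd : HasDerivAt g (-(Complex.I * ∑ k with k ≠ a, (d k : ℂ))) 0 := by
    have h1 : HasDerivAt (fun t : ℝ => ∑ k with k ≠ a, (theta (anisotropy c) t (p k) : ℂ))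
        (∑ k with k ≠ a, (d k : ℂ)) 0 :=
      HasDerivAt.fun_sum fun k _ => (differentiableAt_theta hΔ (hp k)).hasDerivAt.ofReal_comp
    have h2 := ((h1.const_mul Complex.I).neg.cexp).const_mul ((-1 : ℂ) ^ (n - 1))
    refine h2.congr_deriv ?_
    rw [← mul_assoc]
    have h3 : (-1 : ℂ) ^ (n - 1) * Complex.exp (-(Complex.I *
      ∑ k with k ≠ a, (theta (anisotropy c) 0 (p k) : ℂ))) = 1 := hg0
    simp only [Pi.neg_apply]
    rw [h3, one_mul]
  have hwd : HasDerivAt (fun t : ℝ => Complex.exp (Complex.I * t)) Complex.I 0 := by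
    have h1 : HasDerivAt (fun t : ℝ => (t : ℂ)) 1 0 := by
      simpa using (hasDerivAt_id (0 : ℝ)).ofReal_comp
    simpa using (h1.const_mul Complex.I).cexp
  have hnum : HasDerivAt (fun t : ℝ => g t - Complex.exp (Complex.I * t) ^ N)
      (-(Complex.I * ∑ k with k ≠ a, (d k : ℂ)) - N * Complex.I) 0 := by
    refine (hgd.sub (hwd.pow N)).congr_deriv ?_
    simp
  have hnum' := hasDerivAt_iff_tendsto_slope_zero.1 hnum
  have hden' := hasDerivAt_iff_tendsto_slope_zero.1 hwd
  have hcont : Tendsto (fun t : ℝ => Complex.exp (Complex.I * t)) (𝓝[≠] 0) (𝓝 1) := by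
    have : Continuous fun t : ℝ => Complex.exp (Complex.I * t) := by fun_prop
    have h := this.tendsto 0
    simp only [Complex.ofReal_zero, mul_zero, Complex.exp_zero] at h
    exact h.mono_left nhdsWithin_le_nhds
  -- With `w = e^{it}`, `L(w) - 1 = -c² w / (w - 1)`. As `g 0 = 1`, both `g - w^N` and `w - 1`
  -- vanish at `0`, and the limit is a quotient of derivatives.
  have hlim := (hcont.const_mul (-(c : ℂ) ^ 2)).mul (hnum'.div hden' Complex.I_ne_zero)
  have hval : -(c : ℂ) ^ 2 * 1 * ((-(Complex.I * ∑ k with k ≠ a, (d k : ℂ)) - N * Complex.I) /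
      Complex.I) = (c : ℂ) ^ 2 * (N + ∑ k with k ≠ a, (d k : ℂ)) := by
    have := Complex.I_ne_zero
    field_simp
    ring
  rw [hval] at hlim
  refine hlim.congr' ?_
  have hD : D (anisotropy c) ∈ 𝓝 (0 : ℝ) := isOpen_Ioo.mem_nhds (zero_mem_D hΔ)
  filter_upwards [nhdsWithin_le_nhds hD, self_mem_nhdsWithin] with t ht ht0
  have ht0' : t ≠ 0 := ht0
  have hf : fugacity (Function.update p a t) a = Complex.exp (Complex.I * t) := by
    simp [fugacity]
  have hne : Complex.exp (Complex.I * t) ≠ 1 := exp_I_mul_ne_one ht ht0'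
  rw [hsg t ht, hf, L]
  simp only [zero_add, Pi.div_apply, hg0, Complex.ofReal_zero, mul_zero, Complex.exp_zero,
    one_pow, sub_self, sub_zero, Complex.real_smul, Complex.ofReal_inv]
  have h1 : Complex.exp (Complex.I * t) - 1 ≠ 0 := sub_ne_zero.2 hne
  have h2 : 1 - Complex.exp (Complex.I * t) ≠ 0 := sub_ne_zero.2 hne.symm
  have h3 : (t : ℂ) ≠ 0 := by exact_mod_cast ht0'
  rw [show 1 - Complex.exp (Complex.I * t) = -(Complex.exp (Complex.I * t) - 1) by ring]
  field_simp
  ring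

theorem mulVec_betheVector_of_eq_zero {c : ℝ} (hc : 0 < c) {N n : ℕ} (hN : 0 < N)
    {p : Fin n → ℝ} (hp : ∀ j, p j ∈ D (anisotropy c)) (hinj : Function.Injective p)
    (hBE : BetheEquations c N p) {a : Fin n} (ha : p a = 0) :
    ((transferMatrix N c).map Complex.ofReal).mulVec (betheVector c N p) =
      ((2 + (c : ℂ) ^ 2 * ((N : ℂ) - 1) + (c : ℂ) ^ 2 * ∑ j with j ≠ a,
          ((deriv (fun t => theta (anisotropy c) t (p j)) 0 : ℝ) : ℂ)) *
        ∏ j with j ≠ a, M c (fugacity p j)) • betheVector c N p := by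
  have hΔ := anisotropy_lt_one hc
  funext s
  rw [Pi.smul_apply, smul_eq_mul]
  by_cases hs : s.card = n
  swap
  · rw [mulVec_betheVector_of_card_ne c p hs, betheVector, dif_neg hs, mul_zero]
  obtain ⟨m, rfl⟩ : ∃ m, n = m + 1 := ⟨n - 1, by have := a.2; omega⟩
  set x := s.orderEmbOfFin hs with hxdef
  set u : ℝ → Fin (m + 1) → ℝ := fun t => Function.update p a t with hu
  have hu0 : u 0 = p := by rw [hu, ← ha]; exact Function.update_eq_self a p
  have huc : Continuous u := continuous_const.update a continuous_id
  have hut : Tendsto u (𝓝[≠] 0) (𝓝 p) := by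
    have := huc.tendsto 0
    rw [hu0] at this
    exact this.mono_left nhdsWithin_le_nhds
  -- Distinctness of the momenta enters here: only `p a` vanishes.
  have hpj : ∀ j, j ≠ a → p j ≠ 0 := fun j hj h => hj (hinj (h.trans ha.symm))
  have hz : ∀ j, j ≠ a → fugacity p j ≠ 1 := fun j hj => exp_I_mul_ne_one (hp j) (hpj j hj)
  have hpf := pairFactor_ne_zero hΔ hp
  have hscat : ∀ j, scattering c p j = fugacity p j ^ N := hBE.fugacity_pow hΔ hp
  have hscat1 : scattering c p a = 1 := by
    rw [hscat]
    simp [fugacity, ha]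
  have hLM := prod_L_eq_prod_M c p ha hz hpf hscat1
  set K := ∏ j with j ≠ a, M c (fugacity p j) with hK
  set κ : ℝ → ℂ := fun t => (scattering c (u t) a - fugacity (u t) a ^ N) *
    (L c (fugacity (u t) a) - 1) with hκ
  -- The particle `a` is excluded because its remainder has the non-zero limit treated through `κ`;
  -- for the others the first factor tends to 0 by Bethe's equations.
  set h' : ℝ → Fin (m + 1) → ℂ := fun t j => if j = a then 0 else
    (scattering c (u t) j - fugacity p j ^ N) * (L c (fugacity p j) - 1) with hh'
  have hfu : ∀ t j, j ≠ a → fugacity (u t) j = fugacity p j := by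
    intro t j hj
    simp [fugacity, hu, hj]
  have hmain : ∀ t ∈ D (anisotropy c), t ≠ 0 →
      ((transferMatrix N c).map Complex.ofReal).mulVec (betheVector c N (u t)) s =
        (2 - (c : ℂ) ^ 2) * K * betheVector c N (u t) s +
        κ t * ∑ σ : Equiv.Perm (Fin (m + 1)), amplitude c (u t) σ * innerSum c x p σ *
          (if σ (Fin.last m) = a then 1 else 0) +
        ∑ σ : Equiv.Perm (Fin (m + 1)), amplitude c (u t) σ * innerRowSum c x (u t) σ *
          h' t (σ (Fin.last m)) := by
    intro t ht ht0
    have hup : ∀ j, u t j ∈ D (anisotropy c) := by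
      intro j
      by_cases hj : j = a
      · subst hj
        simpa [hu] using ht
      · simpa [hu, hj] using hp j
    have hup0 : ∀ j, u t j ≠ 0 := by
      intro j
      by_cases hj : j = a
      · subst hj
        simpa [hu] using ht0
      · simpa [hu, hj] using hpj j hj
    have hzt : ∀ j, fugacity (u t) j ≠ 1 := fun j => exp_I_mul_ne_one (hup j) (hup0 j)
    -- The poles cancel: the other factors have the same product `K` on both sides, and `L + M = 2 -
    -- c²` identically.
    have hprod : (∏ j, L c (fugacity (u t) j)) + ∏ j, M c (fugacity (u t) j) =
        (2 - (c : ℂ) ^ 2) * K := by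
      have e : ∀ F : ℂ → ℂ, ∏ j, F (fugacity (u t) j) =
          F (fugacity (u t) a) * ∏ j with j ≠ a, F (fugacity p j) := by
        intro F
        rw [← mul_prod_erase univ _ (mem_univ a), filter_ne']
        congr 1
        exact prod_congr rfl fun j hj => by rw [hfu t j (ne_of_mem_erase hj)]
      have h2 : 1 - fugacity (u t) a ≠ 0 := sub_ne_zero.2 (hzt a).symm
      have h3 : L c (fugacity (u t) a) + M c (fugacity (u t) a) = 2 - (c : ℂ) ^ 2 := by
        rw [L, M]
        field_simp
        ring
      rw [e, e, hLM, ← hK, ← add_mul, h3]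
    rw [mulVec_betheVector_eq c hN (u t) hzt (pairFactor_ne_zero hΔ hup) hs, hprod, ← hxdef,
      ← sum_innerSum_eq_sum_innerRowSum c x.strictMono (u t) hzt (h' t), add_assoc, mul_sum,
      ← sum_add_distrib]
    congr 1
    refine sum_congr rfl fun σ _ => ?_
    by_cases hσ : σ (Fin.last m) = a
    -- With `a` in the last place the inner sum involves only the unperturbed momenta.
    · have hin : innerSum c x (u t) σ = innerSum c x p σ := by
        have hne : ∀ k (hk : k < m), σ ⟨k, by omega⟩ ≠ a := by
          intro k hk
          rw [← hσ]
          intro h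
          have := congrArg Fin.val (σ.injective h)
          simp at this
          omega
        refine pathSum_congr (fun k hk => ?_) fun k hk => ?_
        · rw [atPos_of_lt _ σ (show k < m + 1 by omega),
            atPos_of_lt _ σ (show k < m + 1 by omega), leftTerm, leftTerm, hfu t _ (hne k hk)]
        · rw [atPos_of_lt _ σ (show k < m + 1 by omega),
            atPos_of_lt _ σ (show k < m + 1 by omega), rightTerm, rightTerm, hfu t _ (hne k hk)]
      simp only [hκ, hh', hσ, if_true, hin]
      ring
    · simp only [hh', hσ, if_false, hfu t _ hσ]
      ring
  have hψ : Tendsto (fun t => betheVector c N (u t) s) (𝓝[≠] 0) (𝓝 (betheVector c N p s)) :=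
    ((continuous_betheVector c s).tendsto p).comp hut
  have hA : ∀ σ, Tendsto (fun t => amplitude c (u t) σ) (𝓝[≠] 0) (𝓝 (amplitude c p σ)) :=
    fun σ => ((continuous_amplitude c σ).tendsto p).comp hut
  have hleft : Tendsto (fun t => ((transferMatrix N c).map Complex.ofReal).mulVec
      (betheVector c N (u t)) s) (𝓝[≠] 0)
      (𝓝 (((transferMatrix N c).map Complex.ofReal).mulVec (betheVector c N p) s)) := by
    simp only [Matrix.mulVec, dotProduct]
    exact tendsto_finsetSum _ fun t _ =>
      (((continuous_betheVector c t).tendsto p).comp hut).const_mul _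
  have hh'0 : ∀ j, Tendsto (fun t => h' t j) (𝓝[≠] 0) (𝓝 0) := by
    intro j
    by_cases hj : j = a
    · simp only [hh', hj, if_true]
      exact tendsto_const_nhds
    · simp only [hh', hj, if_false]
      have h1 : Tendsto (fun t => scattering c (u t) j) (𝓝[≠] 0) (𝓝 (scattering c p j)) := by
        unfold scattering
        refine Tendsto.const_mul _ (tendsto_finsetProd _ fun k _ => Tendsto.div ?_ ?_ (hpf k j))
        · exact ((continuous_pairFactor c j k).tendsto p).comp hut
        · exact ((continuous_pairFactor c k j).tendsto p).comp hut
      have h2 := (h1.sub_const (fugacity p j ^ N)).mul_const (L c (fugacity p j) - 1)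
      rwa [hscat, sub_self, zero_mul] at h2
  have hκlim := tendsto_scattering_sub_pow (N := N) hc hp ha hscat1
  have hright := (((hψ.const_mul ((2 - (c : ℂ) ^ 2) * K)).add
    (hκlim.mul (tendsto_finsetSum univ fun (σ : Equiv.Perm (Fin (m + 1))) _ =>
      ((hA σ).mul_const (innerSum c x p σ)).mul_const
        (if σ (Fin.last m) = a then (1 : ℂ) else 0)))).add
    (tendsto_finsetSum univ fun (σ : Equiv.Perm (Fin (m + 1))) _ =>
      ((hA σ).mul (((continuous_innerRowSum c x σ).tendsto p).comp hut)).mul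
        (hh'0 (σ (Fin.last m)))))
  have hD : D (anisotropy c) ∈ 𝓝 (0 : ℝ) := isOpen_Ioo.mem_nhds (zero_mem_D hΔ)
  have hev := hright.congr' (f₂ := fun t => ((transferMatrix N c).map Complex.ofReal).mulVec
      (betheVector c N (u t)) s) (by
    filter_upwards [nhdsWithin_le_nhds hD, self_mem_nhdsWithin] with t ht ht0
    exact (hmain t ht ht0).symm)
  rw [tendsto_nhds_unique hleft hev, sum_innerSum_of_zero c p ha hz hs, hLM]
  simp only [mul_zero, sum_const_zero, add_zero]
  ring

end

end SixVertex

theorem theorem2p2 (c : ℝ) (hc : 0 < c) (N n : ℕ) (hN : 0 < N) (hn : 2 * n ≤ N)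
    (p : Fin n → ℝ) (hpD : ∀ j, p j ∈ SixVertex.D (SixVertex.anisotropy c))
    (hp : Function.Injective p) (hBE : SixVertex.BetheEquations c N p) :
    ((∀ j, p j ≠ 0) →
      ((SixVertex.transferMatrix N c).map Complex.ofReal).mulVec (SixVertex.betheVector c N p) =
        ((∏ j, SixVertex.L c (Complex.exp (Complex.I * p j))) +
          ∏ j, SixVertex.M c (Complex.exp (Complex.I * p j))) •
            SixVertex.betheVector c N p) ∧
    (∀ l, p l = 0 →
      (∀ j, j ≠ l →
        DifferentiableAt ℝ (fun t => SixVertex.theta (SixVertex.anisotropy c) t (p j)) 0) ∧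
      ((SixVertex.transferMatrix N c).map Complex.ofReal).mulVec (SixVertex.betheVector c N p) =
        ((2 + (c : ℂ) ^ 2 * ((N : ℂ) - 1) + (c : ℂ) ^ 2 * ∑ j with j ≠ l,
            ((deriv (fun t => SixVertex.theta (SixVertex.anisotropy c) t (p j)) 0 : ℝ) : ℂ)) *
          ∏ j with j ≠ l, SixVertex.M c (Complex.exp (Complex.I * p j))) •
            SixVertex.betheVector c N p) := by
  exact ⟨SixVertex.mulVec_betheVector_of_ne_zero hc hN hpD hBE, fun _ hl =>
    ⟨fun j _ => SixVertex.differentiableAt_theta (SixVertex.anisotropy_lt_one hc) (hpD j),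
      SixVertex.mulVec_betheVector_of_eq_zero hc hN hpD hp hBE hl⟩⟩
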